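/- A principal delegates a search to an agent. There are $n$ boxes; box $i$ has opening cost $c_i\ge 0$ and contains, independently of the other boxes, prize $j\in[m]$ with probability $p_{ij}\ge 0$ (where $\sum_j p_{ij}=1$). Prize $j$ of box $i$ has value $a_{ij}\ge 0$ for the agent and $b_{ij}\ge 0$ for the principal. A contract $T$ specifies payments $t_{ij}\in[0,b_{ij}]$. A policy specifies in every situation, i.e. for every set of opened boxes together with the prizes found in them, either a closed box to open next, or to stop and select the prize of an opened box, or to stop without a prize. If $(i,j)$ is the selected prize, the agent obtains $a_{ij}+t_{ij}$ and the principal obtains $b_{ij}-t_{ij}$ (both obtain $0$ if no prize is selected); in addition the agent pays $c_{i'}$ for every opened box $i'$. A policy is agent-optimal if it maximizes the agent's expected total utility among all policies, and it is optimal under $T$ if it is agent-optimal and maximizes the principal's expected utility among all agent-optimal policies. Theorem. Given such an instance and a contract $T$, all with rational data, an optimal policy under $T$ can be computed in polynomial time: there are one algorithm and one polynomial $q$ such that for every instance and every contract $T$, of total binary encoding length $L$, there is an optimal policy under $T$ whose move in any given situation is computed by the algorithm, from the instance, $T$ and the situation, in time at most $q(L)$ (on a random access machine with logarithmic cost). 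-/

import Mathlib

/-! ## Delegated search over boxes -/

/-- The data of a search problem with `n` boxes and `m` prizes per box: opening costs `c i`,
the probability `p i j` that box `i` contains prize `j`, and the value `a i j` (resp. `b i j`) of
prize `j` of box `i` for the agent (resp. the principal). Numbers are rational since they are the
input of an algorithm. -/
structure SearchProblem (n m : ℕ) where
  c : Fin n → ℚ
  p : Fin n → Fin m → ℚ
  a : Fin n → Fin m → ℚ
  b : Fin n → Fin m → ℚ
  c_nonneg : ∀ i, 0 ≤ c i
  p_nonneg : ∀ i j, 0 ≤ p i j
  p_sum : ∀ i, ∑ j, p i j = 1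
  a_nonneg : ∀ i j, 0 ≤ a i j
  b_nonneg : ∀ i j, 0 ≤ b i j

/-- A contract: if prize `j` of box `i` is selected, the principal pays `t i j ∈ [0, b i j]` to the
agent. -/
structure Contract {n m : ℕ} (I : SearchProblem n m) where
  t : Fin n → Fin m → ℚ
  t_nonneg : ∀ i j, 0 ≤ t i j
  t_le : ∀ i j, t i j ≤ I.b i j

/-- What has been seen so far: `σ i = none` if box `i` is still closed and `σ i = some j` if box `i`
has been opened and prize `j` was found in it. -/
abbrev Situation (n m : ℕ) := Fin n → Option (Fin m)

/-- The possible next moves: open box `i`, stop and select the prize found in box `i`, or stop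
without selecting a prize. -/
inductive Move (n : ℕ) where
  | openBox (i : Fin n)
  | takePrize (i : Fin n)
  | quit

/-- A policy specifies a move in every situation. Only closed boxes can be opened, and only a prize
of an opened box can be selected. -/
structure Policy (n m : ℕ) where
  move : Situation n m → Move n
  open_closed : ∀ σ i, move σ = Move.openBox i → σ i = none
  take_opened : ∀ σ i, move σ = Move.takePrize i → σ i ≠ none

namespace Policy

variable {n m : ℕ}

/-- The situation after (at most) `k` openings when `ω i` is the prize in box `i`. -/
def situationAfter (π : Policy n m) (ω : Fin n → Fin m) : ℕ → Situation n m
  | 0 => fun _ => none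
  | k + 1 =>
    match π.move (π.situationAfter ω k) with
    | Move.openBox i => Function.update (π.situationAfter ω k) i (some (ω i))
    | Move.takePrize _ => π.situationAfter ω k
    | Move.quit => π.situationAfter ω k

/-- The situation in which the policy stops. There are `n` boxes, so that it has stopped after at
most `n` openings. -/
def finalSituation (π : Policy n m) (ω : Fin n → Fin m) : Situation n m :=
  π.situationAfter ω n

/-- The value, with respect to `v`, of the selected prize (`0` if no prize is selected). -/
def selectedValue (π : Policy n m) (v : Fin n → Fin m → ℚ) (ω : Fin n → Fin m) : ℚ :=
  match π.move (π.finalSituation ω) with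
  | Move.takePrize i => v i (ω i)
  | Move.openBox _ => 0
  | Move.quit => 0

/-- The total opening cost paid by the policy. -/
def openingCost (π : Policy n m) (c : Fin n → ℚ) (ω : Fin n → Fin m) : ℚ :=
  ∑ i, if (π.finalSituation ω i).isSome then c i else 0

/-- The policy has stopped in its final situation, so that the second case in the definition of
`selectedValue` never occurs. -/
theorem move_finalSituation_ne_openBox (π : Policy n m) (ω : Fin n → Fin m) (i : Fin n) :
    π.move (π.finalSituation ω) ≠ Move.openBox i := by
  intro h
  have key : ∀ k, k ≤ n + 1 →
      (∀ l < k, ∃ j, π.move (π.situationAfter ω l) = Move.openBox j) →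
      (Finset.univ.filter fun j => (π.situationAfter ω k j).isSome).card = k := by
    intro k
    induction k with
    | zero => intro _ _; simp [situationAfter]
    | succ k ih =>
      intro hk hl
      have ih' := ih (by omega) (fun l hlk => hl l (by omega))
      obtain ⟨j, hj⟩ := hl k (by omega)
      have hnone := π.open_closed _ _ hj
      have hset : (Finset.univ.filter fun j' => (π.situationAfter ω (k + 1) j').isSome)
          = insert j (Finset.univ.filter fun j' => (π.situationAfter ω k j').isSome) := by
        ext j'
        by_cases hjj : j' = j
        · subst hjj; simp [situationAfter, hj]
        · simp [situationAfter, hj, hjj]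
      rw [hset, Finset.card_insert_of_notMem (by simp [hnone]), ih']
  have stay : ∀ k, (∀ j, π.move (π.situationAfter ω k) ≠ Move.openBox j) →
      ∀ d, π.situationAfter ω (k + d) = π.situationAfter ω k := by
    intro k hk d
    induction d with
    | zero => rfl
    | succ d ih =>
      have : π.situationAfter ω (k + (d + 1)) = π.situationAfter ω (k + d) := by
        change π.situationAfter ω (k + d + 1) = _
        rw [situationAfter]
        split
        · next j hj => rw [ih] at hj; exact absurd hj (hk j)
        · rfl
        · rfl
      rw [this, ih]
  have all : ∀ l < n + 1, ∃ j, π.move (π.situationAfter ω l) = Move.openBox j := by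
    intro l hl
    by_contra! hno
    have := stay l hno (n - l)
    rw [show l + (n - l) = n by omega] at this
    rw [finalSituation, this] at h
    exact hno i h
  have h1 := key (n + 1) le_rfl all
  have h2 := Finset.card_le_univ
    (Finset.univ.filter fun j => (π.situationAfter ω (n + 1) j).isSome)
  rw [h1, Fintype.card_fin] at h2
  omega

end Policy

namespace SearchProblem

variable {n m : ℕ}

/-- The expectation of `f` when the prizes in the boxes are drawn independently. -/
def expectation (I : SearchProblem n m) (f : (Fin n → Fin m) → ℚ) : ℚ :=
  ∑ ω : Fin n → Fin m, (∏ i, I.p i (ω i)) * f ω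

/-- The agent's expected total utility. -/
def agentUtility (I : SearchProblem n m) (T : Contract I) (π : Policy n m) : ℚ :=
  I.expectation fun ω =>
    π.selectedValue (fun i j => I.a i j + T.t i j) ω - π.openingCost I.c ω

/-- The principal's expected utility. -/
def principalUtility (I : SearchProblem n m) (T : Contract I) (π : Policy n m) : ℚ :=
  I.expectation fun ω => π.selectedValue (fun i j => I.b i j - T.t i j) ω

/-- `π` maximizes the agent's expected total utility among all policies. -/
def IsAgentOptimal (I : SearchProblem n m) (T : Contract I) (π : Policy n m) : Prop :=
  ∀ π' : Policy n m, I.agentUtility T π' ≤ I.agentUtility T π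

/-- `π` is an optimal policy under `T`: it is agent-optimal, and ties are broken in favour of the
principal, i.e. it maximizes the principal's expected utility among all agent-optimal policies. -/
def IsOptimalPolicy (I : SearchProblem n m) (T : Contract I) (π : Policy n m) : Prop :=
  I.IsAgentOptimal T π ∧
    ∀ π' : Policy n m, I.IsAgentOptimal T π' → I.principalUtility T π' ≤ I.principalUtility T π

end SearchProblem

/-! ## A random access machine with logarithmic cost -/

namespace RAM

/-- The memory of the machine: one integer for each address. -/
abbrev Memory := ℤ → ℤ

/-- The length of an integer in binary, with one more symbol for the sign. -/
def len (x : ℤ) : ℕ := x.natAbs.size + 1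

/-- Arithmetic expressions; `load e` is the content of the cell whose address is the value of `e`
(indirect addressing). -/
inductive Expr where
  | const (k : ℤ)
  | load (e : Expr)
  | add (e₁ e₂ : Expr)
  | sub (e₁ e₂ : Expr)
  | mul (e₁ e₂ : Expr)
  | div (e₁ e₂ : Expr)

namespace Expr

/-- The value of an expression. -/
def eval (s : Memory) : Expr → ℤ
  | const k => k
  | load e => s (e.eval s)
  | add e₁ e₂ => e₁.eval s + e₂.eval s
  | sub e₁ e₂ => e₁.eval s - e₂.eval s
  | mul e₁ e₂ => e₁.eval s * e₂.eval s
  | div e₁ e₂ => e₁.eval s / e₂.eval s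

/-- The time for evaluating an expression: every operation is charged the binary lengths of the
numbers (and addresses) that it works on. -/
def cost (s : Memory) : Expr → ℕ
  | const k => 1 + len k
  | load e => e.cost s + 1 + len (e.eval s) + len (s (e.eval s))
  | add e₁ e₂ => e₁.cost s + e₂.cost s + 1 + len (e₁.eval s) + len (e₂.eval s)
  | sub e₁ e₂ => e₁.cost s + e₂.cost s + 1 + len (e₁.eval s) + len (e₂.eval s)
  | mul e₁ e₂ => e₁.cost s + e₂.cost s + 1 + len (e₁.eval s) + len (e₂.eval s)
  | div e₁ e₂ => e₁.cost s + e₂.cost s + 1 + len (e₁.eval s) + len (e₂.eval s)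

end Expr

/-- Programs. A test succeeds if the value of its expression is positive. -/
inductive Program where
  | skip
  | assign (addr val : Expr)
  | seq (P Q : Program)
  | ite (test : Expr) (P Q : Program)
  | loop (test : Expr) (P : Program)

/-- `Runs P s s' τ`: started with memory `s`, the program `P` halts with memory `s'` in time
`τ`. -/
inductive Runs : Program → Memory → Memory → ℕ → Prop
  | skip (s : Memory) : Runs Program.skip s s 1
  | assign (addr val : Expr) (s : Memory) :
      Runs (Program.assign addr val) s (Function.update s (addr.eval s) (val.eval s))
        (addr.cost s + val.cost s + 1 + len (addr.eval s) + len (val.eval s))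
  | seq {P Q : Program} {s s' s'' : Memory} {τ τ' : ℕ} (hP : Runs P s s' τ)
      (hQ : Runs Q s' s'' τ') : Runs (Program.seq P Q) s s'' (τ + τ')
  | ite_pos {test : Expr} {P Q : Program} {s s' : Memory} {τ : ℕ} (h : 0 < test.eval s)
      (hP : Runs P s s' τ) : Runs (Program.ite test P Q) s s' (test.cost s + 1 + τ)
  | ite_neg {test : Expr} {P Q : Program} {s s' : Memory} {τ : ℕ} (h : ¬ 0 < test.eval s)
      (hQ : Runs Q s s' τ) : Runs (Program.ite test P Q) s s' (test.cost s + 1 + τ)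
  | loop_done {test : Expr} {P : Program} {s : Memory} (h : ¬ 0 < test.eval s) :
      Runs (Program.loop test P) s s (test.cost s + 1)
  | loop_step {test : Expr} {P : Program} {s s' s'' : Memory} {τ τ' : ℕ} (h : 0 < test.eval s)
      (hP : Runs P s s' τ) (hL : Runs (Program.loop test P) s' s'' τ') :
      Runs (Program.loop test P) s s'' (test.cost s + 1 + τ + τ')

/-- The memory that holds the list `L` in the cells `0, 1, 2, …` and `0` in all other cells. -/
def memoryOf (L : List ℤ) : Memory := fun k => if 0 ≤ k then L.getD k.toNat 0 else 0

/-- The number of symbols needed for writing down a list of integers in binary. -/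
def listSize (L : List ℤ) : ℕ := (L.map len).sum

end RAM

/-! ## Input and output of the algorithm -/

/-- A rational number is given by its numerator and its denominator. -/
def ratCode (x : ℚ) : List ℤ := [x.num, (x.den : ℤ)]

/-- A vector of rational numbers, entry by entry. -/
def vectorCode {n : ℕ} (x : Fin n → ℚ) : List ℤ := (List.ofFn fun i => ratCode (x i)).flatten

/-- A matrix of rational numbers, row by row. -/
def matrixCode {n m : ℕ} (x : Fin n → Fin m → ℚ) : List ℤ :=
  (List.ofFn fun i => vectorCode (x i)).flatten

/-- A search problem and a contract, written as a list of integers. -/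
def inputCode {n m : ℕ} (I : SearchProblem n m) (T : Contract I) : List ℤ :=
  [(n : ℤ), (m : ℤ)] ++ vectorCode I.c ++ matrixCode I.p ++ matrixCode I.a ++ matrixCode I.b ++
    matrixCode T.t

/-- A situation, written as a list of integers: `0` for a closed box, and `j + 1` for an opened box
with prize `j` (where prizes are counted from `0`). -/
def situationCode {n m : ℕ} (σ : Situation n m) : List ℤ :=
  List.ofFn fun i => match σ i with
    | none => 0
    | some j => (j : ℤ) + 1

/-- A move, written as an integer. -/
def moveCode {n : ℕ} : Move n → ℤ
  | Move.quit => 0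
  | Move.openBox i => (i : ℤ) + 1
  | Move.takePrize i => -((i : ℤ) + 1)

/-- The program `P` computes the policy `π` for the search problem `I` and the contract `T` in time
`τ`: in every situation it finds, within `τ` time units, the move that `π` makes there. The input
is stored in the cells `0, 1, 2, …`, and the move is returned in cell `0`. -/
def ComputesPolicy {n m : ℕ} (P : RAM.Program) (I : SearchProblem n m) (T : Contract I)
    (π : Policy n m) (τ : ℕ) : Prop :=
  ∀ σ : Situation n m, ∃ (s : RAM.Memory) (τ' : ℕ),
    RAM.Runs P (RAM.memoryOf (inputCode I T ++ situationCode σ)) s τ' ∧ τ' ≤ τ ∧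
      s 0 = moveCode (π.move σ)

/-! ### The course of a search for fixed contents of the boxes -/

namespace Policy

variable {n m : ℕ}

/-! Tie-breaking is absorbed into a single objective: a prize is valued at `a + t + (b - t) / K`,
where `K = scale`. Every agent utility is an integer multiple of `1 / denProd`, the principal's
utility lies between `0` and `N - 1`, where `N` is the product of all `num + 1` in the input, and `K
= N * denProd`. The bonus is therefore smaller than `1 / denProd` and cannot reverse a strict
preference of the agent; among agent-optimal policies it decides in favour of the principal
(`isOptimalPolicy_of_perturbed`).

What remains is Weitzman's Pandora's box problem with one value `x`. Let `r i` be the reservation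
value, for which the expected excess `(x i - r i)⁺` equals `c i`. The decision to open a box is
independent of its content, so in expectation its cost may be replaced by this excess, charged
whenever the box is opened (`expectation_openingCost`). With these charges, no policy gets more than
the maximum of `0` and all `min (x i) (r i)`, for any fixed contents (`capped_value`), whereas a
greedy search attains this maximum for all contents (`greedy_value`). Ties between greedy moves are
irrelevant, so an algorithm may find a greedy move in each situation separately.

The reservation value is the largest of the fractions `(∑ p x - c) / ∑ p` over the upper level sets
of `x` of positive probability (`exists_reservationValue`). Hence a greedy move belongs to the
maximum of `0`, the values in opened boxes, and all these fractions for closed boxes. After scaling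
by powers of `K` the fractions have integer terms and are compared by cross multiplication
(`Tracks.compared`, `exec_mainP`). The length of `K` is at most that of the input (`len_scale`), all
numbers have at most quadratic length (`lenBound`), and the number of rounds of each loop is at most
the input length, so that `Program.steps` yields a polynomial time bound. -/

theorem situationAfter_succ (π : Policy n m) (ω : Fin n → Fin m) (k : ℕ) :
    (∃ i, π.move (π.situationAfter ω k) = .openBox i ∧
      π.situationAfter ω (k + 1) = Function.update (π.situationAfter ω k) i (some (ω i))) ∨
    π.situationAfter ω (k + 1) = π.situationAfter ω k := by
  rw [situationAfter]
  split
  · next i hi => exact .inl ⟨i, hi, rfl⟩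
  · exact .inr rfl
  · exact .inr rfl

theorem eq_of_situationAfter_eq_some (π : Policy n m) (ω : Fin n → Fin m) {i : Fin n} {j : Fin m} :
    ∀ k, π.situationAfter ω k i = some j → j = ω i := by
  intro k
  induction k with
  | zero => simp [situationAfter]
  | succ k ih =>
    rcases π.situationAfter_succ ω k with ⟨i', -, h'⟩ | h' <;> rw [h']
    · by_cases h : i = i'
      · subst h; simp [eq_comm]
      · simpa [h] using ih
    · exact ih

theorem situationAfter_eq_none_of_succ (π : Policy n m) (ω : Fin n → Fin m) {i : Fin n} {k : ℕ}
    (h : π.situationAfter ω (k + 1) i = none) : π.situationAfter ω k i = none := by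
  rcases π.situationAfter_succ ω k with ⟨i', -, h'⟩ | h' <;> rw [h'] at h
  · by_cases hi : i = i'
    · subst hi; simp at h
    · simpa [hi] using h
  · exact h

/-- The course of the search does not depend on the content of a box that stays closed. -/
theorem situationAfter_update (π : Policy n m) (ω : Fin n → Fin m) (i : Fin n) (j : Fin m) :
    ∀ k, π.situationAfter ω k i = none →
      π.situationAfter (Function.update ω i j) k = π.situationAfter ω k := by
  intro k
  induction k with
  | zero => intro _; rfl
  | succ k ih =>
    intro h
    have ih' := ih (π.situationAfter_eq_none_of_succ ω h)
    rw [situationAfter, situationAfter, ih']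
    rw [situationAfter] at h
    split
    · next i' hi' =>
      rw [hi'] at h
      have : i' ≠ i := by rintro rfl; simp at h
      simp [Function.update_of_ne this]
    · rfl
    · rfl

/-- A box is opened before its content is seen. This is the independence needed for
`expectation_openingCost`. -/
theorem isSome_finalSituation_update (π : Policy n m) (ω : Fin n → Fin m) (i : Fin n) (j : Fin m) :
    (π.finalSituation (Function.update ω i j) i).isSome = (π.finalSituation ω i).isSome := by
  by_cases h : π.finalSituation ω i = none
  · rw [finalSituation, situationAfter_update π ω i j n h]; rfl
  · by_cases h' : π.finalSituation (Function.update ω i j) i = none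
    -- Putting `ω i` back undoes the redraw, so the invariance also applies in the reverse
    -- direction.
    · have := situationAfter_update π (Function.update ω i j) i (ω i) n h'
      rw [Function.update_idem, Function.update_eq_self] at this
      exact absurd (by rw [finalSituation, this]; exact h') h
    · rw [← ne_eq, Option.ne_none_iff_isSome] at h h'
      rw [h, h']

theorem selectedValue_add_mul (π : Policy n m) (u v : Fin n → Fin m → ℚ) (e : ℚ)
    (ω : Fin n → Fin m) :
    π.selectedValue (fun i j => u i j + e * v i j) ω
      = π.selectedValue u ω + e * π.selectedValue v ω := by
  unfold selectedValue
  split <;> simp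

/-- The selected box does not depend on `v`, so one case distinction serves the agent's, the
principal's and the perturbed values. -/
theorem selectedValue_cases (π : Policy n m) (ω : Fin n → Fin m) :
    (∃ i, π.finalSituation ω i = some (ω i) ∧ π.move (π.finalSituation ω) = .takePrize i ∧
      ∀ v, π.selectedValue v ω = v i (ω i)) ∨
    (π.move (π.finalSituation ω) = .quit ∧ ∀ v, π.selectedValue v ω = 0) := by
  unfold selectedValue
  cases hm : π.move (π.finalSituation ω) with
  | openBox i => exact absurd hm (π.move_finalSituation_ne_openBox ω i)
  | quit => exact .inr ⟨rfl, fun _ => rfl⟩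
  | takePrize i =>
    refine .inl ⟨i, ?_, rfl, fun _ => rfl⟩
    obtain ⟨j, hj⟩ := Option.ne_none_iff_exists'.1 (π.take_opened _ _ hm)
    rw [hj, π.eq_of_situationAfter_eq_some ω n hj]

end Policy

/-! ### Expectations and redrawing one box -/

namespace SearchProblem

variable {n m : ℕ}

theorem sum_prod_p (I : SearchProblem n m) : ∑ ω : Fin n → Fin m, ∏ i, I.p i (ω i) = 1 := by
  rw [← Fintype.prod_sum]
  simp [I.p_sum]

theorem prod_p_nonneg (I : SearchProblem n m) (ω : Fin n → Fin m) : 0 ≤ ∏ i, I.p i (ω i) :=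
  Finset.prod_nonneg fun i _ => I.p_nonneg i _

theorem expectation_mono (I : SearchProblem n m) {f g : (Fin n → Fin m) → ℚ} (h : ∀ ω, f ω ≤ g ω) :
    I.expectation f ≤ I.expectation g :=
  Finset.sum_le_sum fun ω _ => mul_le_mul_of_nonneg_left (h ω) (I.prod_p_nonneg ω)

theorem expectation_const (I : SearchProblem n m) (y : ℚ) : I.expectation (fun _ => y) = y := by
  rw [expectation, ← Finset.sum_mul, I.sum_prod_p, one_mul]

theorem expectation_sub (I : SearchProblem n m) (f g : (Fin n → Fin m) → ℚ) :
    I.expectation (fun ω => f ω - g ω) = I.expectation f - I.expectation g := by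
  simp [expectation, mul_sub]

theorem expectation_add_mul (I : SearchProblem n m) (f g : (Fin n → Fin m) → ℚ) (e : ℚ) :
    I.expectation (fun ω => f ω + e * g ω) = I.expectation f + e * I.expectation g := by
  simp only [expectation, mul_add, Finset.sum_add_distrib, Finset.mul_sum]
  congr 1
  exact Finset.sum_congr rfl fun _ _ => by ring

theorem expectation_sum (I : SearchProblem n m) (f : Fin n → (Fin n → Fin m) → ℚ) :
    I.expectation (fun ω => ∑ i, f i ω) = ∑ i, I.expectation (f i) := by
  simp only [expectation, Finset.mul_sum]
  exact Finset.sum_comm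

/-- The change of weight is stated without division, since probabilities may be zero. -/
theorem prod_p_update (I : SearchProblem n m) (ω : Fin n → Fin m) (i : Fin n) (j : Fin m) :
    (∏ i', I.p i' (Function.update ω i j i')) * I.p i (ω i) = (∏ i', I.p i' (ω i')) * I.p i j := by
  rw [← Finset.mul_prod_erase _ _ (Finset.mem_univ i),
    ← Finset.mul_prod_erase _ (fun i' => I.p i' (ω i')) (Finset.mem_univ i)]
  have : ∏ x ∈ Finset.univ.erase i, I.p x (Function.update ω i j x)
      = ∏ x ∈ Finset.univ.erase i, I.p x (ω x) :=
    Finset.prod_congr rfl fun x hx => by rw [Function.update_of_ne (Finset.ne_of_mem_erase hx)]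
  rw [this, Function.update_self]
  ring

/-- Drawing the content of one box again does not change expectations. -/
theorem expectation_resample (I : SearchProblem n m) (i : Fin n) (f : (Fin n → Fin m) → ℚ) :
    I.expectation f = I.expectation fun ω => ∑ j, I.p i j * f (Function.update ω i j) := by
  have h1 : I.expectation f = ∑ x : (Fin n → Fin m) × Fin m,
      (∏ i', I.p i' (x.1 i')) * I.p i x.2 * f x.1 := by
    rw [expectation, Fintype.sum_prod_type]
    refine Finset.sum_congr rfl fun ω _ => ?_
    change _ = ∑ j, (∏ i', I.p i' (ω i')) * I.p i j * f ω
    rw [← Finset.sum_mul, ← Finset.mul_sum, I.p_sum, mul_one]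
  have h2 : (I.expectation fun ω => ∑ j, I.p i j * f (Function.update ω i j))
      = ∑ x : (Fin n → Fin m) × Fin m,
        (∏ i', I.p i' (x.1 i')) * I.p i x.2 * f (Function.update x.1 i x.2) := by
    rw [expectation, Fintype.sum_prod_type]
    refine Finset.sum_congr rfl fun ω _ => ?_
    rw [Finset.mul_sum]
    exact Finset.sum_congr rfl fun _ _ => by ring
  rw [h1, h2]
  -- Exchanging the content of box `i` with the fresh draw is an involution that preserves the
  -- weights.
  refine Finset.sum_nbij' (fun x => (Function.update x.1 i x.2, x.1 i))
    (fun x => (Function.update x.1 i x.2, x.1 i)) (by simp) (by simp) (by simp) (by simp) ?_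
  rintro ⟨ω, j⟩ _
  simp [I.prod_p_update]

/-- The opening costs of a policy, in expectation, if `c i` is the expected excess of the value of
box `i` over `r i`. -/
theorem expectation_openingCost (I : SearchProblem n m) (x : Fin n → Fin m → ℚ) (r : Fin n → ℚ)
    (hr : ∀ i, ∑ j, I.p i j * max (x i j - r i) 0 = I.c i) (π : Policy n m) :
    I.expectation (π.openingCost I.c) = I.expectation fun ω =>
      ∑ i, if (π.finalSituation ω i).isSome then max (x i (ω i) - r i) 0 else 0 := by
  have : π.openingCost I.c = fun ω => ∑ i, if (π.finalSituation ω i).isSome then I.c i else 0 := rfl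
  rw [this, expectation_sum, expectation_sum]
  refine Finset.sum_congr rfl fun i _ => ?_
  -- Redrawing box `i` leaves the indicator of its opening unchanged, so only the excess is
  -- averaged, and its mean is `c i`.
  rw [I.expectation_resample i fun ω =>
    if (π.finalSituation ω i).isSome then max (x i (ω i) - r i) 0 else 0]
  congr 1
  ext ω
  simp only [π.isSome_finalSituation_update, Function.update_self]
  split_ifs with h
  · exact (hr i).symm
  · simp

/-! ### Greedy search and Weitzman's theorem -/

/-- The value of an opened box, or the reservation value of a closed box. -/
def score (x : Fin n → Fin m → ℚ) (r : Fin n → ℚ) (σ : Situation n m) (i : Fin n) : ℚ :=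
  match σ i with
  | none => r i
  | some j => x i j

/-- The move `mv` goes for the highest score. -/
def IsGreedyMove (x : Fin n → Fin m → ℚ) (r : Fin n → ℚ) (σ : Situation n m) : Move n → Prop
  | Move.openBox i => σ i = none ∧ 0 ≤ r i ∧ ∀ i', score x r σ i' ≤ r i
  | Move.takePrize i => σ i ≠ none ∧ 0 ≤ score x r σ i ∧ ∀ i', score x r σ i' ≤ score x r σ i
  | Move.quit => ∀ i', score x r σ i' ≤ 0

/-- During a greedy search, a box with more value than its reservation value is selected as soon as
it has been opened. -/
theorem greedy_invariant (x : Fin n → Fin m → ℚ) (r : Fin n → ℚ) (π : Policy n m)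
    (hπ : ∀ σ, IsGreedyMove x r σ (π.move σ)) (ω : Fin n → Fin m) (k : ℕ) :
    (∀ i, (π.situationAfter ω k i).isSome → x i (ω i) ≤ r i) ∨
    (∃ i, π.situationAfter ω k i = some (ω i) ∧ r i < x i (ω i) ∧ 0 ≤ r i ∧
      ∀ i' ≠ i, score x r (π.situationAfter ω k) i' ≤ r i ∧
        ((π.situationAfter ω k i').isSome → x i' (ω i') ≤ r i')) := by
  induction k with
  | zero => left; simp [Policy.situationAfter]
  | succ k ih =>
    have hg := hπ (π.situationAfter ω k)
    rcases π.situationAfter_succ ω k with ⟨i, hi, h'⟩ | h' <;> rw [h']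
    · rw [hi] at hg
      obtain ⟨hnone, h0, hle⟩ := hg
      rcases ih with ih | ⟨i₀, h1, h2, h3, h4⟩
      · by_cases hx : x i (ω i) ≤ r i
        · left
          intro i'
          by_cases h : i' = i
          · subst h; exact fun _ => hx
          · simpa [h] using ih i'
        · right
          refine ⟨i, by simp, not_le.1 hx, h0, fun i' h => ⟨?_, ?_⟩⟩
          · have := hle i'
            simp only [score, Function.update_of_ne h] at this ⊢
            exact this
          · simpa [h] using ih i'
      -- A further opening is impossible here: the score `x i₀ > r i₀` of the opened box strictly
      -- exceeds the score of every other box.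
      · have hne : i ≠ i₀ := by rintro rfl; rw [h1] at hnone; cases hnone
        have a1 := hle i₀
        have a2 := (h4 i hne).1
        simp only [score, h1, hnone] at a1 a2
        exact absurd (h2.trans_le (a1.trans a2)) (lt_irrefl _)
    · exact ih

/-- By `greedy_invariant` at most one opened box exceeds its reservation value. If there is one, it
is selected and its charge reduces the gain to exactly `r`, which dominates the other scores. If
there is none, nothing is charged and the highest score, or `0`, is obtained. Scores dominate the
capped values in either case. -/
theorem greedy_value (x : Fin n → Fin m → ℚ) (r : Fin n → ℚ) (π : Policy n m)
    (hπ : ∀ σ, IsGreedyMove x r σ (π.move σ)) (ω : Fin n → Fin m) :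
    0 ≤ π.selectedValue x ω -
        (∑ i, if (π.finalSituation ω i).isSome then max (x i (ω i) - r i) 0 else 0) ∧
    ∀ i, min (x i (ω i)) (r i) ≤ π.selectedValue x ω -
        (∑ i, if (π.finalSituation ω i).isSome then max (x i (ω i) - r i) 0 else 0) := by
  have hinv := greedy_invariant x r π hπ ω n
  rw [show π.situationAfter ω n = π.finalSituation ω from rfl] at hinv
  have hg := hπ (π.finalSituation ω)
  have hκ : ∀ i, min (x i (ω i)) (r i) ≤ score x r (π.finalSituation ω) i := by
    intro i
    unfold score
    split
    · exact min_le_right _ _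
    · next j hj => rw [π.eq_of_situationAfter_eq_some ω n hj]; exact min_le_left _ _
  rcases hinv with h | ⟨i₀, h1, h2, h3, h4⟩
  · have : (∑ i, if (π.finalSituation ω i).isSome then max (x i (ω i) - r i) 0 else 0) = 0 := by
      refine Finset.sum_eq_zero fun i _ => ?_
      split_ifs with hi
      · exact max_eq_right (sub_nonpos.2 (h i hi))
      · rfl
    rw [this, sub_zero]
    rcases π.selectedValue_cases ω with ⟨i, hi, hm, hv⟩ | ⟨hm, hv⟩
    · rw [hm] at hg
      obtain ⟨-, g1, g2⟩ := hg
      have : score x r (π.finalSituation ω) i = x i (ω i) := by simp [score, hi]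
      rw [this] at g1 g2
      rw [hv]
      exact ⟨g1, fun i' => (hκ i').trans (g2 i')⟩
    · rw [hm] at hg
      rw [hv]
      exact ⟨le_rfl, fun i' => (hκ i').trans (hg i')⟩
  · have hs0 : score x r (π.finalSituation ω) i₀ = x i₀ (ω i₀) := by simp [score, h1]
    have : (∑ i, if (π.finalSituation ω i).isSome then max (x i (ω i) - r i) 0 else 0)
        = x i₀ (ω i₀) - r i₀ := by
      rw [Finset.sum_eq_single i₀]
      · simp [h1, h2.le]
      · intro i _ hi
        split_ifs with hs
        · exact max_eq_right (sub_nonpos.2 ((h4 i hi).2 hs))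
        · rfl
      · simp
    have hv : π.selectedValue x ω = x i₀ (ω i₀) := by
      rcases π.selectedValue_cases ω with ⟨i, hi, hm, hv⟩ | ⟨hm, hv⟩
      · rw [hv]
        by_cases hne : i = i₀
        · rw [hne]
        · rw [hm] at hg
          have := (hg.2.2 i₀).trans (h4 i hne).1
          rw [hs0] at this
          exact absurd this (not_le.2 h2)
      · rw [hm] at hg
        have := (hg i₀).trans h3
        rw [hs0] at this
        exact absurd this (not_le.2 h2)
    rw [this, hv, sub_sub_cancel]
    refine ⟨h3, fun i => ?_⟩
    by_cases hne : i = i₀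
    · rw [hne]; exact min_le_right _ _
    · exact (hκ i).trans (h4 i hne).1

/-- No policy gets, for fixed contents of the boxes, more than the best value that is capped by the
reservation value. -/
theorem capped_value (x : Fin n → Fin m → ℚ) (r : Fin n → ℚ) (π : Policy n m)
    (ω : Fin n → Fin m) (z : ℚ) (h0 : 0 ≤ z) (hz : ∀ i, min (x i (ω i)) (r i) ≤ z) :
    π.selectedValue x ω -
        (∑ i, if (π.finalSituation ω i).isSome then max (x i (ω i) - r i) 0 else 0) ≤ z := by
  have hnn : ∀ i ∈ Finset.univ, 0 ≤
      if (π.finalSituation ω i).isSome then max (x i (ω i) - r i) 0 else 0 := by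
    intro i _
    split_ifs
    · exact le_max_right _ _
    · exact le_rfl
  rcases π.selectedValue_cases ω with ⟨i, hi, -, hv⟩ | ⟨-, hv⟩
  · have h1 := Finset.single_le_sum hnn (Finset.mem_univ i)
    rw [hi, Option.isSome_some, if_pos rfl] at h1
    have h2 := hz i
    rw [hv]
    -- If the cap is not active, nonnegativity of the charges suffices; if it is, the charge of the
    -- selected box itself brings the gain down to `r i`.
    rcases min_cases (x i (ω i)) (r i) with ⟨e, -⟩ | ⟨e, -⟩ <;> rw [e] at h2
    · have := Finset.sum_nonneg hnn
      linarith
    · have := le_max_left (x i (ω i) - r i) 0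
      linarith
  · rw [hv]
    have := Finset.sum_nonneg hnn
    linarith

/-- Weitzman's theorem: greedy search with respect to reservation values is optimal. -/
theorem greedy_optimal (I : SearchProblem n m) (x : Fin n → Fin m → ℚ) (r : Fin n → ℚ)
    (hr : ∀ i, ∑ j, I.p i j * max (x i j - r i) 0 = I.c i) (π : Policy n m)
    (hπ : ∀ σ, IsGreedyMove x r σ (π.move σ)) (π' : Policy n m) :
    I.expectation (fun ω => π'.selectedValue x ω - π'.openingCost I.c ω)
      ≤ I.expectation (fun ω => π.selectedValue x ω - π.openingCost I.c ω) := by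
  rw [expectation_sub, expectation_sub, I.expectation_openingCost x r hr,
    I.expectation_openingCost x r hr, ← expectation_sub, ← expectation_sub]
  -- With excesses in place of costs the comparison holds for each `ω` separately.
  refine I.expectation_mono fun ω => ?_
  obtain ⟨h0, h1⟩ := greedy_value x r π hπ ω
  exact capped_value x r π' ω _ h0 h1

end SearchProblem

/-! ### Reservation values as maxima of fractions -/

/-- The equation for the reservation value has a solution, which is the largest of the fractions
`(∑ p j * x j - c) / ∑ p j` where the sums extend over the prizes with value at least `x k`. -/
theorem exists_reservationValue {m : ℕ} (p x : Fin m → ℚ) (c : ℚ) (hp : ∀ j, 0 ≤ p j)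
    (hsum : ∑ j, p j = 1) (hc : 0 ≤ c) :
    ∃ r, ∑ j, p j * max (x j - r) 0 = c ∧ ∀ y, r ≤ y ↔ ∀ k,
      (∑ j, if x k ≤ x j then p j * x j else 0) - c ≤ y * ∑ j, if x k ≤ x j then p j else 0 := by
  have hsub : ∀ k y, (∑ j, if x k ≤ x j then p j * x j else 0)
      - y * (∑ j, if x k ≤ x j then p j else 0) = ∑ j, if x k ≤ x j then p j * (x j - y) else 0 := by
    intro k y
    rw [Finset.mul_sum, ← Finset.sum_sub_distrib]
    refine Finset.sum_congr rfl fun j _ => ?_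
    split_ifs <;> ring
  have hle : ∀ k y, (∑ j, if x k ≤ x j then p j * (x j - y) else 0)
      ≤ ∑ j, p j * max (x j - y) 0 := by
    intro k y
    refine Finset.sum_le_sum fun j _ => ?_
    split_ifs
    · exact mul_le_mul_of_nonneg_left (le_max_left _ _) (hp j)
    · exact mul_nonneg (hp j) (le_max_right _ _)
  have hF : ∀ y, (∀ k, (∑ j, if x k ≤ x j then p j * x j else 0) - c
      ≤ y * ∑ j, if x k ≤ x j then p j else 0) → ∑ j, p j * max (x j - y) 0 ≤ c := by
    intro y h
    by_cases hne : (Finset.univ.filter fun j => y < x j).Nonempty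
    -- For the least value `x k` above `y`, the level set of `k` consists of exactly the prizes with
    -- value above `y`, so its sum is the sum of positive parts.
    · obtain ⟨k, hk, hmin⟩ := Finset.exists_min_image _ x hne
      have h1 := h k
      have h2 := hsub k y
      have h3 : (∑ j, if x k ≤ x j then p j * (x j - y) else 0)
          = ∑ j, p j * max (x j - y) 0 := by
        refine Finset.sum_congr rfl fun j _ => ?_
        simp only [Finset.mem_filter, Finset.mem_univ, true_and] at hk hmin
        split_ifs with hj
        · rw [max_eq_left (by linarith)]
        · have : ¬ y < x j := fun h' => hj (hmin j h')
          rw [max_eq_right (by linarith), mul_zero]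
      linarith
    · rw [Finset.not_nonempty_iff_eq_empty, Finset.filter_eq_empty_iff] at hne
      refine le_trans (le_of_eq (Finset.sum_eq_zero fun j _ => ?_)) hc
      have := hne (Finset.mem_univ j)
      rw [max_eq_right (by linarith), mul_zero]
  have hP0 : ∀ k, 0 ≤ ∑ j, if x k ≤ x j then p j else 0 := fun k =>
    Finset.sum_nonneg fun j _ => by split_ifs; exacts [hp j, le_rfl]
  have hne : (Finset.univ.filter fun k => 0 < ∑ j, if x k ≤ x j then p j else 0).Nonempty := by
    have : Nonempty (Fin m) := by
      by_contra h
      rw [not_nonempty_iff] at h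
      simp at hsum
    -- The level set of a prize of least value contains all prizes and has probability one.
    obtain ⟨k, -, hk⟩ := Finset.exists_min_image Finset.univ x Finset.univ_nonempty
    refine ⟨k, ?_⟩
    simp only [Finset.mem_filter, Finset.mem_univ, true_and] at hk ⊢
    simp [hk, hsum]
  obtain ⟨k, hk, hmax⟩ := Finset.exists_max_image _ (fun k =>
    ((∑ j, if x k ≤ x j then p j * x j else 0) - c) / ∑ j, if x k ≤ x j then p j else 0) hne
  simp only [Finset.mem_filter, Finset.mem_univ, true_and] at hk hmax
  set r := ((∑ j, if x k ≤ x j then p j * x j else 0) - c) / ∑ j, if x k ≤ x j then p j else 0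
    with hr
  have hr' : (∑ j, if x k ≤ x j then p j * x j else 0) - c
      = r * ∑ j, if x k ≤ x j then p j else 0 := by
    rw [hr, div_mul_cancel₀ _ hk.ne']
  have hmain : ∀ y, r ≤ y ↔ ∀ k,
      (∑ j, if x k ≤ x j then p j * x j else 0) - c
        ≤ y * ∑ j, if x k ≤ x j then p j else 0 := by
    intro y
    constructor
    · intro hy k'
      rcases (hP0 k').lt_or_eq with hpos | hzero
      · exact (div_le_iff₀ hpos).1 ((hmax k' hpos).trans hy)
      -- A level set of probability zero contributes nothing to the numerator either, so the claim
      -- reduces to `-c ≤ 0`.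
      · rw [← hzero, mul_zero]
        have h0 : ∀ j, (if x k' ≤ x j then p j else 0) = 0 := fun j =>
          (Finset.sum_eq_zero_iff_of_nonneg
            (fun j _ => by split_ifs; exacts [hp j, le_rfl])).1 hzero.symm j (Finset.mem_univ j)
        have : (∑ j, if x k' ≤ x j then p j * x j else 0) = 0 :=
          Finset.sum_eq_zero fun j _ => by
            have := h0 j
            split_ifs at this ⊢ with h
            · rw [this, zero_mul]
            · rfl
        linarith
    · intro h
      exact (div_le_iff₀ hk).2 (h k)
  -- For the remaining inequality, the sum of `p j * (x j - r)` over the maximizing level set equals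
  -- `c` and is bounded by the sum of positive parts.
  refine ⟨r, le_antisymm (hF r ((hmain r).1 le_rfl)) ?_, hmain⟩
  have h1 := hsub k r
  have h2 := hle k r
  linarith

/-! ### Tie-breaking by perturbation -/

namespace SearchProblem

variable {n m : ℕ}

theorem agentUtility_add_mul (I : SearchProblem n m) (T : Contract I) (π : Policy n m) (e : ℚ) :
    I.expectation (fun ω => π.selectedValue
        (fun i j => I.a i j + T.t i j + e * (I.b i j - T.t i j)) ω - π.openingCost I.c ω)
      = I.agentUtility T π + e * I.principalUtility T π := by
  rw [agentUtility, principalUtility, ← expectation_add_mul]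
  congr 1
  ext ω
  rw [π.selectedValue_add_mul]
  ring

theorem principalUtility_mem_Icc (I : SearchProblem n m) (T : Contract I) (π : Policy n m) (B : ℚ)
    (hB : 0 ≤ B) (hb : ∀ i j, I.b i j ≤ B) : I.principalUtility T π ∈ Set.Icc 0 B := by
  have h : ∀ ω, π.selectedValue (fun i j => I.b i j - T.t i j) ω ∈ Set.Icc 0 B := by
    intro ω
    rcases π.selectedValue_cases ω with ⟨i, -, -, hv⟩ | ⟨-, hv⟩ <;> rw [hv]
    · exact ⟨sub_nonneg.2 (T.t_le _ _), (sub_le_self _ (T.t_nonneg _ _)).trans (hb _ _)⟩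
    · exact ⟨le_rfl, hB⟩
  exact ⟨(I.expectation_const 0).symm.le.trans (I.expectation_mono fun ω => (h ω).1),
    (I.expectation_mono fun ω => (h ω).2).trans (I.expectation_const B).le⟩

/-- A policy is optimal under `T` if it is optimal after adding a tiny fraction of the principal's
utility to the utility of the agent. -/
theorem isOptimalPolicy_of_perturbed (I : SearchProblem n m) (T : Contract I) (D K B : ℚ)
    (hD : 0 < D) (hint : ∀ π, ∃ z : ℤ, D * I.agentUtility T π = z) (hB : 0 ≤ B)
    (hb : ∀ i j, I.b i j ≤ B) (hK : D * B < K) (π : Policy n m)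
    (hπ : ∀ π' : Policy n m, I.agentUtility T π' + K⁻¹ * I.principalUtility T π'
      ≤ I.agentUtility T π + K⁻¹ * I.principalUtility T π) : I.IsOptimalPolicy T π := by
  have hK0 : 0 < K := (mul_nonneg hD.le hB).trans_lt hK
  have hKi : 0 < K⁻¹ := inv_pos.2 hK0
  have hDB : D * (K⁻¹ * B) < 1 := by
    rw [show D * (K⁻¹ * B) = D * B / K by ring]
    exact (div_lt_one hK0).2 hK
  refine ⟨fun π' => ?_, fun π' hπ' => ?_⟩
  · obtain ⟨z, hz⟩ := hint π
    obtain ⟨z', hz'⟩ := hint π'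
    have h1 := (I.principalUtility_mem_Icc T π B hB hb).2
    have h2 := (I.principalUtility_mem_Icc T π' B hB hb).1
    have h3 : I.agentUtility T π' ≤ I.agentUtility T π + K⁻¹ * B := by
      have a1 := mul_le_mul_of_nonneg_left h1 hKi.le
      have a2 := mul_nonneg hKi.le h2
      have := hπ π'
      linarith
    -- After multiplication by `D` the agent's utilities are integers, while the bonus contributes
    -- less than one.
    have h4 : (z' : ℚ) < z + 1 := by
      have := mul_le_mul_of_nonneg_left h3 hD.le
      rw [mul_add, hz, hz'] at this
      linarith
    have h5 : z' ≤ z := by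
      have : z' < z + 1 := by exact_mod_cast h4
      omega
    refine le_of_mul_le_mul_left ?_ hD
    rw [hz, hz']
    exact_mod_cast h5
  -- Since `π'` is agent-optimal, the agent gets at least as much from it as from `π`; the perturbed
  -- inequality then leaves only the principal's terms.
  · have h1 := hπ' π
    have h2 := hπ π'
    have : K⁻¹ * I.principalUtility T π' ≤ K⁻¹ * I.principalUtility T π := by linarith
    exact le_of_mul_le_mul_left this hKi

/-! ### A sufficiently large scale -/

/-- The rational numbers of the input in the order of `inputCode`. -/
def inputRats (I : SearchProblem n m) (T : Contract I) : List ℚ :=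
  List.ofFn I.c ++ (List.ofFn fun i => List.ofFn (I.p i)).flatten ++
    (List.ofFn fun i => List.ofFn (I.a i)).flatten ++
    (List.ofFn fun i => List.ofFn (I.b i)).flatten ++
    (List.ofFn fun i => List.ofFn (T.t i)).flatten

theorem inputRats_nonneg (I : SearchProblem n m) (T : Contract I) :
    ∀ x ∈ I.inputRats T, 0 ≤ x := by
  intro x hx
  simp only [inputRats, List.append_assoc, List.mem_append, List.mem_flatten, List.mem_ofFn] at hx
  rcases hx with ⟨i, rfl⟩ | ⟨_, ⟨i, rfl⟩, hx⟩ | ⟨_, ⟨i, rfl⟩, hx⟩ | ⟨_, ⟨i, rfl⟩, hx⟩ | ⟨_, ⟨i, rfl⟩, hx⟩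
  · exact I.c_nonneg i
  all_goals
    obtain ⟨j, rfl⟩ := (List.mem_ofFn' _ _).1 hx
    first
      | exact I.p_nonneg i j
      | exact I.a_nonneg i j
      | exact I.b_nonneg i j
      | exact T.t_nonneg i j

/-- The product of all denominators in the input. -/
def denProd (I : SearchProblem n m) (T : Contract I) : ℤ :=
  ((I.inputRats T).map fun x => (x.den : ℤ)).prod

/-- The common scale of all numbers in the computation. -/
def scale (I : SearchProblem n m) (T : Contract I) : ℤ :=
  ((I.inputRats T).map fun x => (x.num + 1) * (x.den : ℤ)).prod

theorem prod_map_flatten_ofFn (f : Fin n → Fin m → ℚ) (g : ℚ → ℤ) :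
    (((List.ofFn fun i => List.ofFn (f i)).flatten).map g).prod = ∏ i, ∏ j, g (f i j) := by
  rw [List.map_flatten, List.prod_flatten, List.map_map, List.map_ofFn, List.prod_ofFn]
  refine Finset.prod_congr rfl fun i _ => ?_
  simp [List.map_ofFn, List.prod_ofFn]

theorem denProd_eq (I : SearchProblem n m) (T : Contract I) :
    I.denProd T = (∏ i, ((I.c i).den : ℤ)) * (∏ i, ∏ j, ((I.p i j).den : ℤ)) *
      (∏ i, ∏ j, ((I.a i j).den : ℤ)) * (∏ i, ∏ j, ((I.b i j).den : ℤ)) *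
      (∏ i, ∏ j, ((T.t i j).den : ℤ)) := by
  simp only [denProd, inputRats, List.map_append, List.prod_append, List.map_ofFn,
    prod_map_flatten_ofFn]
  simp [List.prod_ofFn]

theorem denProd_pos (I : SearchProblem n m) (T : Contract I) : 0 < I.denProd T := by
  refine List.prod_pos fun x hx => ?_
  obtain ⟨y, -, rfl⟩ := List.mem_map.1 hx
  exact_mod_cast y.den_pos

theorem scale_eq (I : SearchProblem n m) (T : Contract I) :
    I.scale T = ((I.inputRats T).map fun x => x.num + 1).prod * I.denProd T :=
  List.prod_map_mul

theorem dvd_prod_prod (f : Fin n → Fin m → ℤ) (i : Fin n) (j : Fin m) :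
    f i j ∣ ∏ i, ∏ j, f i j :=
  (Finset.dvd_prod_of_mem (f i) (Finset.mem_univ j)).trans
    (Finset.dvd_prod_of_mem (fun i => ∏ j, f i j) (Finset.mem_univ i))

theorem mul_mem_range_intCast {d : ℤ} {x : ℚ} (h : (x.den : ℤ) ∣ d) :
    (d : ℚ) * x ∈ (Int.castRingHom ℚ).range := by
  obtain ⟨e, rfl⟩ := h
  refine ⟨e * x.num, ?_⟩
  have := Rat.den_mul_eq_num x
  simp only [eq_intCast]
  push_cast
  rw [← this]
  ring

/-- The weight of an outcome uses one probability per box, so the product over all boxes of all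
denominators clears it. The denominators of `c`, `a` and `t` are separate factors and clear the
payoff; those of `b` are not needed but do no harm. -/
theorem exists_denProd_mul_agentUtility (I : SearchProblem n m) (T : Contract I)
    (π : Policy n m) : ∃ z : ℤ, (I.denProd T : ℚ) * I.agentUtility T π = z := by
  suffices h : (I.denProd T : ℚ) * I.agentUtility T π ∈ (Int.castRingHom ℚ).range by
    obtain ⟨z, hz⟩ := h
    exact ⟨z, hz.symm⟩
  rw [agentUtility, expectation, Finset.mul_sum]
  refine sum_mem fun ω _ => ?_
  set DC := ∏ i, ((I.c i).den : ℤ) with hDC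
  set DA := ∏ i, ∏ j, ((I.a i j).den : ℤ) with hDA
  set DB := ∏ i, ∏ j, ((I.b i j).den : ℤ) with hDB
  set DT := ∏ i, ∏ j, ((T.t i j).den : ℤ) with hDT
  have hD : (I.denProd T : ℚ) = DC * (∏ i, ((∏ j, ((I.p i j).den : ℤ) : ℤ) : ℚ)) * DA * DB * DT := by
    rw [denProd_eq, ← hDC, ← hDA, ← hDB, ← hDT]
    push_cast
    ring
  have hi : ∀ z : ℤ, (z : ℚ) ∈ (Int.castRingHom ℚ).range := fun z => ⟨z, rfl⟩
  have hp : (∏ i, ((∏ j, ((I.p i j).den : ℤ) : ℤ) : ℚ)) * (∏ i, I.p i (ω i))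
      ∈ (Int.castRingHom ℚ).range := by
    rw [← Finset.prod_mul_distrib]
    exact prod_mem fun i _ => mul_mem_range_intCast
      (Finset.dvd_prod_of_mem (fun j => ((I.p i j).den : ℤ)) (Finset.mem_univ (ω i)))
  have hs : (DC * DA * DT : ℚ) * π.selectedValue (fun i j => I.a i j + T.t i j) ω
      ∈ (Int.castRingHom ℚ).range := by
    rcases π.selectedValue_cases ω with ⟨i, -, -, hv⟩ | ⟨-, hv⟩ <;> rw [hv]
    · have h1 : (DA : ℚ) * I.a i (ω i) ∈ (Int.castRingHom ℚ).range :=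
        mul_mem_range_intCast (dvd_prod_prod (fun i j => ((I.a i j).den : ℤ)) i (ω i))
      have h2 : (DT : ℚ) * T.t i (ω i) ∈ (Int.castRingHom ℚ).range :=
        mul_mem_range_intCast (dvd_prod_prod (fun i j => ((T.t i j).den : ℤ)) i (ω i))
      have := add_mem (mul_mem (mul_mem (hi DC) (hi DT)) h1) (mul_mem (mul_mem (hi DC) (hi DA)) h2)
      convert this using 1
      ring
    · rw [mul_zero]; exact zero_mem _
  have hc : (DC * DA * DT : ℚ) * π.openingCost I.c ω ∈ (Int.castRingHom ℚ).range := by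
    rw [Policy.openingCost, Finset.mul_sum]
    refine sum_mem fun i _ => ?_
    split_ifs
    · have h1 : (DC : ℚ) * I.c i ∈ (Int.castRingHom ℚ).range :=
        mul_mem_range_intCast
          (Finset.dvd_prod_of_mem (fun i => ((I.c i).den : ℤ)) (Finset.mem_univ i))
      convert mul_mem (mul_mem (hi DA) (hi DT)) h1 using 1
      ring
    · rw [mul_zero]; exact zero_mem _
  rw [hD]
  convert mul_mem (mul_mem (hi DB) hp) (sub_mem hs hc) using 1
  ring

theorem numProd_pos (I : SearchProblem n m) (T : Contract I) :
    0 < ((I.inputRats T).map fun x => x.num + 1).prod := by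
  refine List.prod_pos fun x hx => ?_
  obtain ⟨y, hy, rfl⟩ := List.mem_map.1 hx
  have := Rat.num_nonneg.2 (I.inputRats_nonneg T y hy)
  omega

theorem scale_pos (I : SearchProblem n m) (T : Contract I) : 0 < I.scale T := by
  rw [scale_eq]
  exact mul_pos (I.numProd_pos T) (I.denProd_pos T)

theorem b_mem_inputRats (I : SearchProblem n m) (T : Contract I) (i : Fin n) (j : Fin m) :
    I.b i j ∈ I.inputRats T := by
  simp only [inputRats, List.append_assoc, List.mem_append, List.mem_flatten]
  exact .inr (.inr (.inr (.inl ⟨_, (List.mem_ofFn' _ _).2 ⟨i, rfl⟩, (List.mem_ofFn' _ _).2 ⟨j, rfl⟩⟩)))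

theorem den_dvd_scale (I : SearchProblem n m) (T : Contract I) {x : ℚ} (hx : x ∈ I.inputRats T) :
    (x.den : ℤ) ∣ I.scale T := by
  rw [scale_eq]
  exact (List.dvd_prod (List.mem_map.2 ⟨x, hx, rfl⟩)).mul_left _

/-- Each `num + 1` is a positive factor of the product, even for zero entries. The gain of `-1`
makes the bound on the perturbation strict. -/
theorem b_le_numProd (I : SearchProblem n m) (T : Contract I) (i : Fin n) (j : Fin m) :
    I.b i j ≤ (((I.inputRats T).map fun x => x.num + 1).prod - 1 : ℤ) := by
  have hdvd : (I.b i j).num + 1 ∣ ((I.inputRats T).map fun x => x.num + 1).prod :=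
    List.dvd_prod (List.mem_map.2 ⟨_, I.b_mem_inputRats T i j, rfl⟩)
  have h1 := Int.le_of_dvd (I.numProd_pos T) hdvd
  have h2 : I.b i j ≤ (I.b i j).num := by
    have h3 := Rat.den_mul_eq_num (I.b i j)
    have h4 : (1 : ℚ) ≤ (I.b i j).den := by exact_mod_cast (I.b i j).den_pos
    have := mul_le_mul_of_nonneg_right h4 (I.b_nonneg i j)
    linarith
  refine h2.trans ?_
  exact_mod_cast (by omega : (I.b i j).num ≤ ((I.inputRats T).map fun x => x.num + 1).prod - 1)

/-- The value of a prize for the agent, with a tiny share of its value for the principal. -/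
def perturbedValue (I : SearchProblem n m) (T : Contract I) (i : Fin n) (j : Fin m) : ℚ :=
  I.a i j + T.t i j + (I.scale T : ℚ)⁻¹ * (I.b i j - T.t i j)

theorem isOptimalPolicy_of_greedy (I : SearchProblem n m) (T : Contract I) (r : Fin n → ℚ)
    (hr : ∀ i, ∑ j, I.p i j * max (I.perturbedValue T i j - r i) 0 = I.c i) (π : Policy n m)
    (hπ : ∀ σ, IsGreedyMove (I.perturbedValue T) r σ (π.move σ)) : I.IsOptimalPolicy T π := by
  have hN := I.numProd_pos T
  have hD := I.denProd_pos T
  refine I.isOptimalPolicy_of_perturbed T (I.denProd T) (I.scale T)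
    (((I.inputRats T).map fun x => x.num + 1).prod - 1 : ℤ) (by exact_mod_cast hD)
    (I.exists_denProd_mul_agentUtility T) (by exact_mod_cast (by omega)) (I.b_le_numProd T) ?_ π
    fun π' => ?_
  -- This is `D * (N - 1) < N * D`, with `N` the product of the `num + 1`.
  · rw [scale_eq]
    exact_mod_cast (by nlinarith)
  · rw [← agentUtility_add_mul, ← agentUtility_add_mul]
    exact I.greedy_optimal _ r hr π hπ π'

end SearchProblem

/-! ### Lengths of numbers and running times -/

namespace RAM

theorem one_le_len (x : ℤ) : 1 ≤ len x := Nat.le_add_left _ _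

theorem natAbs_lt_two_pow_len (x : ℤ) : x.natAbs < 2 ^ x.natAbs.size := Nat.lt_size_self _

theorem len_le_of_natAbs_lt {x : ℤ} {k : ℕ} (h : x.natAbs < 2 ^ k) : len x ≤ k + 1 :=
  Nat.add_le_add_right (Nat.size_le.2 h) 1

theorem len_mono {x y : ℤ} (h : x.natAbs ≤ y.natAbs) : len x ≤ len y :=
  Nat.add_le_add_right (Nat.size_le_size h) 1

theorem len_neg (x : ℤ) : len (-x) = len x := by simp [len]

/-- The two sign symbols leave room for the carry: for sizes `a` and `b` the sum is below `2 ^ (a +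
b + 1)`. -/
theorem len_add (x y : ℤ) : len (x + y) ≤ len x + len y := by
  have hx := natAbs_lt_two_pow_len x
  have hy := natAbs_lt_two_pow_len y
  have h1 : 2 ^ x.natAbs.size ≤ 2 ^ (x.natAbs.size + y.natAbs.size) :=
    Nat.pow_le_pow_right (by norm_num) (by omega)
  have h2 : 2 ^ y.natAbs.size ≤ 2 ^ (x.natAbs.size + y.natAbs.size) :=
    Nat.pow_le_pow_right (by norm_num) (by omega)
  have h3 := Int.natAbs_add_le x y
  have := @len_le_of_natAbs_lt (x + y) (x.natAbs.size + y.natAbs.size + 1) (by rw [pow_succ]; omega)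
  unfold len at *
  omega

theorem len_sub (x y : ℤ) : len (x - y) ≤ len x + len y := by
  rw [sub_eq_add_neg, ← len_neg y]
  exact len_add _ _

theorem len_mul (x y : ℤ) : len (x * y) ≤ len x + len y := by
  have hx := natAbs_lt_two_pow_len x
  have hy := natAbs_lt_two_pow_len y
  have := @len_le_of_natAbs_lt (x * y) (x.natAbs.size + y.natAbs.size)
    (by rw [Int.natAbs_mul, pow_add]; exact Nat.mul_lt_mul'' hx hy)
  unfold len at *
  omega

theorem len_ediv (x y : ℤ) : len (x / y) ≤ len x + len y :=
  (len_mono (Int.natAbs_ediv_le_natAbs x y)).trans (Nat.le_add_right _ _)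

/-- All numbers in the memory have length at most `B`. -/
def Memory.Bounded (s : Memory) (B : ℕ) : Prop := ∀ x, len (s x) ≤ B

theorem Memory.Bounded.one_le {s : Memory} {B : ℕ} (h : s.Bounded B) : 1 ≤ B :=
  (one_le_len _).trans (h 0)

namespace Expr

/-- The value of an expression is at most `width` times as long as the numbers in the memory. -/
def width : Expr → ℕ
  | const k => len k
  | load _ => 1
  | add e₁ e₂ => e₁.width + e₂.width
  | sub e₁ e₂ => e₁.width + e₂.width
  | mul e₁ e₂ => e₁.width + e₂.width
  | div e₁ e₂ => e₁.width + e₂.width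

/-- Each of the four operations at most adds the lengths of its arguments, so the growth is linear
even for products. -/
theorem len_eval_le (s : Memory) (B : ℕ) (h : s.Bounded B) (e : Expr) :
    len (e.eval s) ≤ e.width * B := by
  induction e with
  | const k => exact Nat.le_mul_of_pos_right _ h.one_le
  | load e _ => simpa [width, eval] using h _
  | add e₁ e₂ h₁ h₂ => exact (len_add _ _).trans (by rw [width, add_mul]; exact add_le_add h₁ h₂)
  | sub e₁ e₂ h₁ h₂ => exact (len_sub _ _).trans (by rw [width, add_mul]; exact add_le_add h₁ h₂)
  | mul e₁ e₂ h₁ h₂ => exact (len_mul _ _).trans (by rw [width, add_mul]; exact add_le_add h₁ h₂)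
  | div e₁ e₂ h₁ h₂ => exact (len_ediv _ _).trans (by rw [width, add_mul]; exact add_le_add h₁ h₂)

/-- The evaluation of an expression takes at most `steps` times as long as the numbers in the
memory. -/
def steps : Expr → ℕ
  | const k => 1 + len k
  | load e => e.steps + 1 + e.width + 1
  | add e₁ e₂ => e₁.steps + e₂.steps + 1 + e₁.width + e₂.width
  | sub e₁ e₂ => e₁.steps + e₂.steps + 1 + e₁.width + e₂.width
  | mul e₁ e₂ => e₁.steps + e₂.steps + 1 + e₁.width + e₂.width
  | div e₁ e₂ => e₁.steps + e₂.steps + 1 + e₁.width + e₂.width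

theorem cost_le (s : Memory) (B : ℕ) (h : s.Bounded B) (e : Expr) : e.cost s ≤ e.steps * B := by
  have hB := h.one_le
  have hw := len_eval_le s B h
  induction e with
  | const k => exact Nat.le_mul_of_pos_right _ hB
  | load e ih =>
    have h1 := hw e
    have h2 := h (e.eval s)
    simp only [cost, steps, add_mul]
    omega
  | add e₁ e₂ h₁ h₂ | sub e₁ e₂ h₁ h₂ | mul e₁ e₂ h₁ h₂ | div e₁ e₂ h₁ h₂ =>
    have a₁ := hw e₁
    have a₂ := hw e₂
    simp only [cost, steps, add_mul]
    omega

end Expr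

/-- The number of steps of a program whose loops are executed at most `X` times each. -/
noncomputable def Program.steps : Program → Polynomial ℕ
  | skip => 1
  | assign addr val => .C (addr.steps + val.steps + 1 + addr.width + val.width)
  | seq P Q => P.steps + Q.steps
  | ite test P Q => .C (test.steps + 1) + P.steps + Q.steps
  | loop test P => (.X + 1) * (.C (test.steps + 1) + P.steps)

/-- Started with memory `s`, the program `P` halts with a memory that satisfies `Post`, within the
time that is sufficient if the numbers have length at most `B` and each loop is executed at most `T`
times. -/
def Exec (T B : ℕ) (P : Program) (s : Memory) (Post : Memory → Prop) : Prop :=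
  ∃ s' τ, Runs P s s' τ ∧ τ ≤ P.steps.eval T * B ∧ Post s'

namespace Exec

variable {T B : ℕ} {P Q : Program} {s : Memory} {Post Post' : Memory → Prop}

theorem mono (h : Exec T B P s Post) (hp : ∀ s', Post s' → Post' s') : Exec T B P s Post' := by
  obtain ⟨s', τ, h1, h2, h3⟩ := h
  exact ⟨s', τ, h1, h2, hp _ h3⟩

theorem assign {addr val : Expr} (hs : s.Bounded B)
    (h : Post (Function.update s (addr.eval s) (val.eval s))) :
    Exec T B (.assign addr val) s Post := by
  refine ⟨_, _, Runs.assign addr val s, ?_, h⟩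
  have h1 := addr.cost_le s B hs
  have h2 := val.cost_le s B hs
  have h3 := addr.len_eval_le s B hs
  have h4 := val.len_eval_le s B hs
  have := hs.one_le
  simp only [Program.steps, Polynomial.eval_C, add_mul]
  omega

theorem seq (h : Exec T B P s fun s' => Exec T B Q s' Post) : Exec T B (.seq P Q) s Post := by
  obtain ⟨s', τ, h1, h2, s'', τ', h1', h2', h3⟩ := h
  refine ⟨s'', τ + τ', h1.seq h1', ?_, h3⟩
  simp only [Program.steps, Polynomial.eval_add, add_mul]
  omega

theorem ite {test : Expr} (hs : s.Bounded B) (h₁ : 0 < test.eval s → Exec T B P s Post)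
    (h₂ : ¬ 0 < test.eval s → Exec T B Q s Post) : Exec T B (.ite test P Q) s Post := by
  have hc := test.cost_le s B hs
  have hB := hs.one_le
  by_cases h : 0 < test.eval s
  · obtain ⟨s', τ, a1, a2, a3⟩ := h₁ h
    refine ⟨s', _, Runs.ite_pos h a1, ?_, a3⟩
    simp only [Program.steps, Polynomial.eval_add, Polynomial.eval_C, add_mul]
    omega
  · obtain ⟨s', τ, a1, a2, a3⟩ := h₂ h
    refine ⟨s', _, Runs.ite_neg h a1, ?_, a3⟩
    simp only [Program.steps, Polynomial.eval_add, Polynomial.eval_C, add_mul]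
    omega

theorem skip (hB : 1 ≤ B) (h : Post s) : Exec T B .skip s Post :=
  ⟨s, 1, Runs.skip s, by simpa [Program.steps] using hB, h⟩

/-- A loop that is executed `n` times. -/
theorem loop {test : Expr} (n : ℕ) (hn : n ≤ T) (Inv : ℕ → Memory → Prop)
    (hb : ∀ k ≤ n, ∀ s, Inv k s → s.Bounded B ∧ (0 < test.eval s ↔ k < n))
    (hP : ∀ k < n, ∀ s, Inv k s → Exec T B P s (Inv (k + 1))) (h0 : Inv 0 s) :
    Exec T B (.loop test P) s (Inv n) := by
  -- Here `d` counts the remaining rounds; the extra unit in `d + 1` pays for the final, failing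
  -- test.
  suffices h : ∀ d k s, k + d = n → Inv k s → ∃ s' τ, Runs (.loop test P) s s' τ ∧
      τ ≤ (d + 1) * ((test.steps + 1 + P.steps.eval T) * B) ∧ Inv n s' by
    obtain ⟨s', τ, h1, h2, h3⟩ := h n 0 s (by omega) h0
    refine ⟨s', τ, h1, h2.trans ?_, h3⟩
    simp only [Program.steps, Polynomial.eval_add, Polynomial.eval_C, Polynomial.eval_mul,
      Polynomial.eval_X, Polynomial.eval_one, mul_assoc]
    exact Nat.mul_le_mul_right _ (by omega)
  intro d
  induction d with
  | zero =>
    intro k s hk hi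
    obtain ⟨h1, h2⟩ := hb k (by omega) s hi
    have hc := test.cost_le s B h1
    have hB := h1.one_le
    refine ⟨s, _, Runs.loop_done (by rw [h2]; omega), ?_, ?_⟩
    · simp only [zero_add, one_mul, add_mul]
      omega
    · rwa [← (by omega : k = n)]
  | succ d ih =>
    intro k s hk hi
    obtain ⟨h1, h2⟩ := hb k (by omega) s hi
    have hc := test.cost_le s B h1
    have hB := h1.one_le
    obtain ⟨s', τ, a1, a2, a3⟩ := hP k (by omega) s hi
    obtain ⟨s'', τ', b1, b2, b3⟩ := ih (k + 1) s' (by omega) a3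
    refine ⟨s'', _, Runs.loop_step (h2.2 (by omega)) a1 b1, ?_, b3⟩
    rw [add_mul (d + 1) 1]
    simp only [add_mul _ _ B, one_mul] at b2 ⊢
    omega

end Exec

end RAM

/-! ### The program -/

namespace SearchProgram

open RAM

/-- The working variables of the program. -/
structure Vars where
  K : ℤ
  i : ℤ
  k : ℤ
  j : ℤ
  N : ℤ
  Q : ℤ
  BN : ℤ
  BD : ℤ
  BM : ℤ

/-- The memory with input `g` and with the variables in the cells with negative addresses. -/
def mem (g : Memory) (v : Vars) : Memory := fun x =>
  if x = -1 then v.K else if x = -2 then v.i else if x = -3 then v.k else if x = -4 then v.j else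
  if x = -5 then v.N else if x = -6 then v.Q else if x = -7 then v.BN else if x = -8 then v.BD else
  if x = -9 then v.BM else g x

section mem

variable (g : Memory) (v : Vars) (y : ℤ)

/-- Variables occupy negative addresses only, so assigning to them leaves the input intact. -/
theorem mem_of_nonneg {x : ℤ} (hx : 0 ≤ x) : mem g v x = g x := by
  unfold mem
  repeat rw [if_neg (by omega)]

theorem update_K : Function.update (mem g v) (-1) y = mem g { v with K := y } := by
  funext x
  by_cases h : x = -1
  · subst h; rw [Function.update_self]; rfl
  · rw [Function.update_of_ne h]; simp only [mem, if_neg h]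

theorem update_i : Function.update (mem g v) (-2) y = mem g { v with i := y } := by
  funext x
  by_cases h : x = -2
  · subst h; rw [Function.update_self]; rfl
  · rw [Function.update_of_ne h]; simp only [mem, if_neg h]

theorem update_k : Function.update (mem g v) (-3) y = mem g { v with k := y } := by
  funext x
  by_cases h : x = -3
  · subst h; rw [Function.update_self]; rfl
  · rw [Function.update_of_ne h]; simp only [mem, if_neg h]

theorem update_j : Function.update (mem g v) (-4) y = mem g { v with j := y } := by
  funext x
  by_cases h : x = -4
  · subst h; rw [Function.update_self]; rfl
  · rw [Function.update_of_ne h]; simp only [mem, if_neg h]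

theorem update_N : Function.update (mem g v) (-5) y = mem g { v with N := y } := by
  funext x
  by_cases h : x = -5
  · subst h; rw [Function.update_self]; rfl
  · rw [Function.update_of_ne h]; simp only [mem, if_neg h]

theorem update_Q : Function.update (mem g v) (-6) y = mem g { v with Q := y } := by
  funext x
  by_cases h : x = -6
  · subst h; rw [Function.update_self]; rfl
  · rw [Function.update_of_ne h]; simp only [mem, if_neg h]

theorem update_BN : Function.update (mem g v) (-7) y = mem g { v with BN := y } := by
  funext x
  by_cases h : x = -7
  · subst h; rw [Function.update_self]; rfl
  · rw [Function.update_of_ne h]; simp only [mem, if_neg h]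

theorem update_BD : Function.update (mem g v) (-8) y = mem g { v with BD := y } := by
  funext x
  by_cases h : x = -8
  · subst h; rw [Function.update_self]; rfl
  · rw [Function.update_of_ne h]; simp only [mem, if_neg h]

theorem update_BM : Function.update (mem g v) (-9) y = mem g { v with BM := y } := by
  funext x
  by_cases h : x = -9
  · subst h; rw [Function.update_self]; rfl
  · rw [Function.update_of_ne h]; simp only [mem, if_neg h]

/-- All variables have length at most `B`. -/
structure Vars.Bounded (v : Vars) (B : ℕ) : Prop where
  K : len v.K ≤ B
  i : len v.i ≤ B
  k : len v.k ≤ B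
  j : len v.j ≤ B
  N : len v.N ≤ B
  Q : len v.Q ≤ B
  BN : len v.BN ≤ B
  BD : len v.BD ≤ B
  BM : len v.BM ≤ B

variable {g v} {B : ℕ}

theorem Vars.Bounded.mem (hv : v.Bounded B) (hg : g.Bounded B) : (mem g v).Bounded B := by
  intro x
  unfold SearchProgram.mem
  split_ifs
  exacts [hv.K, hv.i, hv.k, hv.j, hv.N, hv.Q, hv.BN, hv.BD, hv.BM, hg x]

variable {T : ℕ} {e : Expr} {Post : Memory → Prop}

theorem exec_K (hs : (mem g v).Bounded B) (h : Post (mem g { v with K := e.eval (mem g v) })) :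
    Exec T B (.assign (.const (-1)) e) (mem g v) Post :=
  .assign hs (by rw [← update_K] at h; exact h)

theorem exec_i (hs : (mem g v).Bounded B) (h : Post (mem g { v with i := e.eval (mem g v) })) :
    Exec T B (.assign (.const (-2)) e) (mem g v) Post :=
  .assign hs (by rw [← update_i] at h; exact h)

theorem exec_k (hs : (mem g v).Bounded B) (h : Post (mem g { v with k := e.eval (mem g v) })) :
    Exec T B (.assign (.const (-3)) e) (mem g v) Post :=
  .assign hs (by rw [← update_k] at h; exact h)

theorem exec_j (hs : (mem g v).Bounded B) (h : Post (mem g { v with j := e.eval (mem g v) })) :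
    Exec T B (.assign (.const (-4)) e) (mem g v) Post :=
  .assign hs (by rw [← update_j] at h; exact h)

theorem exec_N (hs : (mem g v).Bounded B) (h : Post (mem g { v with N := e.eval (mem g v) })) :
    Exec T B (.assign (.const (-5)) e) (mem g v) Post :=
  .assign hs (by rw [← update_N] at h; exact h)

theorem exec_Q (hs : (mem g v).Bounded B) (h : Post (mem g { v with Q := e.eval (mem g v) })) :
    Exec T B (.assign (.const (-6)) e) (mem g v) Post :=
  .assign hs (by rw [← update_Q] at h; exact h)

theorem exec_BN (hs : (mem g v).Bounded B) (h : Post (mem g { v with BN := e.eval (mem g v) })) :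
    Exec T B (.assign (.const (-7)) e) (mem g v) Post :=
  .assign hs (by rw [← update_BN] at h; exact h)

theorem exec_BD (hs : (mem g v).Bounded B) (h : Post (mem g { v with BD := e.eval (mem g v) })) :
    Exec T B (.assign (.const (-8)) e) (mem g v) Post :=
  .assign hs (by rw [← update_BD] at h; exact h)

theorem exec_BM (hs : (mem g v).Bounded B) (h : Post (mem g { v with BM := e.eval (mem g v) })) :
    Exec T B (.assign (.const (-9)) e) (mem g v) Post :=
  .assign hs (by rw [← update_BM] at h; exact h)

end mem

open Expr in
/-- The rational number with index `q`, multiplied by `K`. -/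
def scaledE (q : Expr) : Expr :=
  div (mul (load (const (-1))) (load (add (const 2) (mul (const 2) q))))
    (load (add (const 3) (mul (const 2) q)))

open Expr in
/-- The index of entry `(i, j)` of the matrix with number `b` in the input. -/
def entryE (b : ℤ) (j : Expr) : Expr :=
  add (add (load (const 0)) (mul (const b) (mul (load (const 0)) (load (const 1)))))
    (add (mul (load (const (-2))) (load (const 1))) j)

open Expr in
/-- The scaled perturbed value of prize `j` of box `i`. -/
def valueE (j : Expr) : Expr :=
  add (mul (load (const (-1))) (add (scaledE (entryE 1 j)) (scaledE (entryE 3 j))))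
    (sub (scaledE (entryE 2 j)) (scaledE (entryE 3 j)))

open Expr in
/-- The number of rational numbers in the input. -/
def countE : Expr :=
  add (load (const 0)) (mul (const 4) (mul (load (const 0)) (load (const 1))))

open Expr in
/-- The entry of the situation that belongs to box `i`. -/
def situationE : Expr :=
  load (add (add (const 2) (mul (const 2) countE)) (load (const (-2))))

open Expr Program in
/-- Computes the common scale `K`. -/
def scaleP : Program :=
  seq (assign (const (-1)) (const 1)) <|
  loop (sub countE (load (const (-2)))) <|
  seq (assign (const (-1)) (mul (load (const (-1)))
    (mul (add (load (add (const 2) (mul (const 2) (load (const (-2)))))) (const 1))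
      (load (add (const 3) (mul (const 2) (load (const (-2)))))))))
  (assign (const (-2)) (add (load (const (-2))) (const 1)))

open Expr Program in
/-- Computes numerator and denominator of the fraction that belongs to prize `k` of box `i`. -/
def sumP : Program :=
  seq (assign (const (-5)) (sub (const 0) (mul (scaledE (load (const (-2))))
    (mul (load (const (-1))) (load (const (-1))))))) <|
  seq (assign (const (-6)) (const 0)) <|
  seq (assign (const (-4)) (const 0)) <|
  loop (sub (load (const 1)) (load (const (-4)))) <|
  seq (ite (add (sub (valueE (load (const (-4)))) (valueE (load (const (-3))))) (const 1))
    (seq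
      (assign (const (-5)) (add (load (const (-5)))
        (mul (scaledE (entryE 0 (load (const (-4))))) (valueE (load (const (-4)))))))
      (assign (const (-6)) (add (load (const (-6))) (scaledE (entryE 0 (load (const (-4))))))))
    skip)
  (assign (const (-4)) (add (load (const (-4))) (const 1)))

open Expr Program in
/-- Replaces the best move so far if the fraction `N / Q` is larger. -/
def compareP (code : Expr) : Program :=
  ite (sub (mul (load (const (-5))) (load (const (-8)))) (mul (load (const (-7))) (load (const (-6)))))
    (seq (assign (const (-7)) (load (const (-5)))) <|
      seq (assign (const (-8)) (load (const (-6)))) <|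
      assign (const (-9)) code)
    skip

open Expr Program in
/-- Treats an opened box. -/
def openedP : Program :=
  seq (assign (const (-5)) (valueE (sub situationE (const 1)))) <|
  seq (assign (const (-6)) (const 1)) <|
  compareP (sub (const 0) (add (load (const (-2))) (const 1)))

open Expr Program in
/-- Treats a closed box. -/
def closedP : Program :=
  seq (assign (const (-3)) (const 0)) <|
  loop (sub (load (const 1)) (load (const (-3)))) <|
  seq sumP <|
  seq (compareP (add (load (const (-2))) (const 1))) <|
  assign (const (-3)) (add (load (const (-3))) (const 1))

open Expr Program in
/-- The algorithm. -/
def mainP : Program :=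
  seq scaleP <|
  seq (assign (const (-2)) (const 0)) <|
  seq (assign (const (-8)) (const 1)) <|
  seq (loop (sub (load (const 0)) (load (const (-2)))) <|
    seq (ite situationE openedP closedP) <|
    assign (const (-2)) (add (load (const (-2))) (const 1))) <|
  assign (const 0) (load (const (-9)))

/-! ### The integers computed by the expressions -/

/-- The memory `g` contains the input: the rational numbers `R` and the situation `S`. -/
structure InputAt (g : Memory) (n m A : ℕ) (R : ℕ → ℚ) (S : ℕ → ℤ) : Prop where
  zero : g 0 = n
  one : g 1 = m
  num : ∀ q : ℕ, q < n + 4 * (n * m) → g (2 + 2 * q) = (R q).num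
  den : ∀ q : ℕ, q < n + 4 * (n * m) → g (3 + 2 * q) = (R q).den
  situation : ∀ i : ℕ, i < n → g (2 + 2 * (n + 4 * (n * m)) + i) = S i
  bounded : g.Bounded A
  count_le : n + 4 * (n * m) ≤ A

/-- The number `y`, multiplied by `K`. -/
def scaled (K : ℤ) (y : ℚ) : ℤ := K * y.num / y.den

/-- The scaled perturbed value of prize `j` of box `i`. -/
def value (n m : ℕ) (K : ℤ) (R : ℕ → ℚ) (i j : ℕ) : ℤ :=
  K * (scaled K (R (n + 1 * (n * m) + (i * m + j))) + scaled K (R (n + 3 * (n * m) + (i * m + j)))) +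
    (scaled K (R (n + 2 * (n * m) + (i * m + j))) - scaled K (R (n + 3 * (n * m) + (i * m + j))))

/-- The scaled probability of prize `j` of box `i`. -/
def prob (n m : ℕ) (K : ℤ) (R : ℕ → ℚ) (i j : ℕ) : ℤ :=
  scaled K (R (n + 0 * (n * m) + (i * m + j)))

/-- The numerator of the fraction that belongs to prize `k` of box `i`, as far as it comes from the
first `d` prizes. -/
def numer (n m : ℕ) (K : ℤ) (R : ℕ → ℚ) (i k d : ℕ) : ℤ :=
  (∑ j ∈ Finset.range d, if value n m K R i k ≤ value n m K R i j then
    prob n m K R i j * value n m K R i j else 0) - scaled K (R i) * (K * K)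

/-- The denominator of the fraction that belongs to prize `k` of box `i`, as far as it comes from
the first `d` prizes. -/
def denom (n m : ℕ) (K : ℤ) (R : ℕ → ℚ) (i k d : ℕ) : ℤ :=
  ∑ j ∈ Finset.range d, if value n m K R i k ≤ value n m K R i j then prob n m K R i j else 0

theorem entry_lt {n m i j b : ℕ} (hi : i < n) (hj : j < m) (hb : b ≤ 3) :
    n + b * (n * m) + (i * m + j) < n + 4 * (n * m) := by
  have h1 : (i + 1) * m ≤ n * m := Nat.mul_le_mul_right m hi
  have h2 : b * (n * m) ≤ 3 * (n * m) := Nat.mul_le_mul_right _ hb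
  rw [add_mul] at h1
  omega

section eval

variable {g : Memory} {n m A : ℕ} {R : ℕ → ℚ} {S : ℕ → ℤ}

theorem eval_scaledE (hin : InputAt g n m A R S) {v : Vars} {q : Expr} {a : ℕ}
    (hq : q.eval (mem g v) = a) (ha : a < n + 4 * (n * m)) :
    (scaledE q).eval (mem g v) = scaled v.K (R a) := by
  have h1 : mem g v (2 + 2 * (a : ℤ)) = (R a).num := by
    rw [mem_of_nonneg _ _ (by positivity), hin.num a ha]
  have h2 : mem g v (3 + 2 * (a : ℤ)) = (R a).den := by
    rw [mem_of_nonneg _ _ (by positivity), hin.den a ha]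
  simp only [scaledE, Expr.eval, hq, h1, h2]
  rfl

theorem eval_entryE (hin : InputAt g n m A R S) {v : Vars} {i j : ℕ} (b : ℕ) {e : Expr}
    (he : e.eval (mem g v) = j) (hi : v.i = i) :
    (entryE b e).eval (mem g v) = ((n + b * (n * m) + (i * m + j) : ℕ) : ℤ) := by
  have h0 : mem g v 0 = n := by rw [mem_of_nonneg _ _ le_rfl, hin.zero]
  have h1 : mem g v 1 = m := by rw [mem_of_nonneg _ _ (by norm_num), hin.one]
  have h2 : mem g v (-2) = i := hi
  simp only [entryE, Expr.eval, he, h0, h1, h2]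
  push_cast
  rfl

theorem eval_valueE (hin : InputAt g n m A R S) {v : Vars} {i j : ℕ} {e : Expr}
    (he : e.eval (mem g v) = j) (hi : v.i = i) (hi' : i < n) (hj : j < m) :
    (valueE e).eval (mem g v) = value n m v.K R i j := by
  have h1 := eval_scaledE hin (eval_entryE hin 1 he hi) (entry_lt hi' hj (by norm_num))
  have h2 := eval_scaledE hin (eval_entryE hin 2 he hi) (entry_lt hi' hj (by norm_num))
  have h3 := eval_scaledE hin (eval_entryE hin 3 he hi) (entry_lt hi' hj (by norm_num))
  have hK : mem g v (-1) = v.K := rfl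
  push_cast at h1 h2 h3
  simp only [valueE, Expr.eval, h1, h2, h3, hK]
  rfl

theorem eval_probE (hin : InputAt g n m A R S) {v : Vars} {i j : ℕ} {e : Expr}
    (he : e.eval (mem g v) = j) (hi : v.i = i) (hi' : i < n) (hj : j < m) :
    (scaledE (entryE 0 e)).eval (mem g v) = prob n m v.K R i j := by
  have h1 := eval_scaledE hin (eval_entryE hin 0 he hi) (entry_lt hi' hj (by norm_num))
  push_cast at h1
  exact h1

theorem eval_countE (hin : InputAt g n m A R S) {v : Vars} :
    countE.eval (mem g v) = ((n + 4 * (n * m) : ℕ) : ℤ) := by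
  have h0 : mem g v 0 = n := by rw [mem_of_nonneg _ _ le_rfl, hin.zero]
  have h1 : mem g v 1 = m := by rw [mem_of_nonneg _ _ (by norm_num), hin.one]
  simp only [countE, Expr.eval, h0, h1]
  push_cast
  rfl

theorem eval_situationE (hin : InputAt g n m A R S) {v : Vars} {i : ℕ} (hi : v.i = i)
    (hi' : i < n) : situationE.eval (mem g v) = S i := by
  have h2 : mem g v (-2) = i := hi
  have := hin.situation i hi'
  rw [← mem_of_nonneg g v (by positivity)] at this
  simp only [situationE, Expr.eval, eval_countE hin, h2]
  push_cast
  exact this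

end eval

/-! ### Lengths of the intermediate numbers -/

section lengths

variable {g : Memory} {n m A : ℕ} {R : ℕ → ℚ} {S : ℕ → ℤ} {K : ℤ}

theorem len_natCast_le (k : ℕ) : len (k : ℤ) ≤ k + 1 :=
  len_le_of_natAbs_lt (by simpa using Nat.lt_two_pow_self)

theorem len_scaled (hin : InputAt g n m A R S) (hK : len K ≤ A) {q : ℕ}
    (hq : q < n + 4 * (n * m)) : len (scaled K (R q)) ≤ 3 * A := by
  have h1 := hin.bounded (2 + 2 * q)
  have h2 := hin.bounded (3 + 2 * q)
  rw [hin.num q hq] at h1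
  rw [hin.den q hq] at h2
  have h3 := len_ediv (K * (R q).num) (R q).den
  have h4 := len_mul K (R q).num
  unfold scaled
  omega

/-- Each scaled entry costs `3 * A` for `K`, numerator and denominator; four of them and one more
factor `K` give `13 * A`. -/
theorem len_value (hin : InputAt g n m A R S) (hK : len K ≤ A) {i j : ℕ} (hi : i < n) (hj : j < m) :
    len (value n m K R i j) ≤ 13 * A := by
  have h1 := len_scaled hin hK (entry_lt (b := 1) hi hj (by norm_num))
  have h2 := len_scaled hin hK (entry_lt (b := 2) hi hj (by norm_num))
  have h3 := len_scaled hin hK (entry_lt (b := 3) hi hj (by norm_num))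
  unfold value
  refine (len_add _ _).trans ?_
  have h4 := len_mul K (scaled K (R (n + 1 * (n * m) + (i * m + j))) +
    scaled K (R (n + 3 * (n * m) + (i * m + j))))
  have h5 := len_add (scaled K (R (n + 1 * (n * m) + (i * m + j))))
    (scaled K (R (n + 3 * (n * m) + (i * m + j))))
  have h6 := len_sub (scaled K (R (n + 2 * (n * m) + (i * m + j))))
    (scaled K (R (n + 3 * (n * m) + (i * m + j))))
  omega

/-- The scaled cost times `K * K` accounts for `5 * A`, and each summand for `3 * A` from the
probability and `13 * A` from the value. -/
theorem len_numer (hin : InputAt g n m A R S) (hK : len K ≤ A) {i k : ℕ} (hi : i < n) {d : ℕ}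
    (hd : d ≤ m) : len (numer n m K R i k d) ≤ 5 * A + d * (16 * A) + 1 := by
  induction d with
  | zero =>
    have h1 := len_scaled hin hK (q := i) (by omega)
    have h2 := len_mul K K
    have h3 := len_mul (scaled K (R i)) (K * K)
    simp only [numer, Finset.range_zero, Finset.sum_empty, zero_sub, len_neg]
    omega
  | succ d ih =>
    have h1 := ih (by omega)
    have h2 := len_value hin hK hi (j := d) (by omega)
    have h3 : len (prob n m K R i d) ≤ 3 * A :=
      len_scaled hin hK (entry_lt (b := 0) hi (by omega) (by norm_num))
    have h4 := len_mul (prob n m K R i d) (value n m K R i d)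
    have h5 := len_add (numer n m K R i k d) (prob n m K R i d * value n m K R i d)
    have : numer n m K R i k (d + 1) = numer n m K R i k d +
        if value n m K R i k ≤ value n m K R i d then
          prob n m K R i d * value n m K R i d else 0 := by
      simp only [numer, Finset.sum_range_succ]
      ring
    rw [this, add_mul d 1]
    split_ifs
    · omega
    · rw [add_zero]; omega

theorem len_denom (hin : InputAt g n m A R S) (hK : len K ≤ A) {i k : ℕ} (hi : i < n) {d : ℕ}
    (hd : d ≤ m) : len (denom n m K R i k d) ≤ d * (3 * A) + 1 := by
  induction d with
  | zero => simp [denom, len]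
  | succ d ih =>
    have h1 := ih (by omega)
    have h3 : len (prob n m K R i d) ≤ 3 * A :=
      len_scaled hin hK (entry_lt (b := 0) hi (by omega) (by norm_num))
    have h5 := len_add (denom n m K R i k d) (prob n m K R i d)
    rw [denom, Finset.sum_range_succ, ← denom, add_mul d 1]
    split_ifs
    · omega
    · rw [add_zero]; omega

end lengths

/-- A bound for the lengths of all numbers in the computation. -/
def lenBound (A : ℕ) : ℕ := 21 * (A + 2) ^ 2

/-- The term `13 * A` covers the scaled values; the constant, which is the bound at `A = 0`, covers
small constants and shifted indices. -/
theorem le_lenBound (A : ℕ) : 13 * A + 84 ≤ lenBound A := by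
  unfold lenBound
  nlinarith

/-! ### Summation over a level set -/

section exec

variable {g : Memory} {n m A : ℕ} {R : ℕ → ℚ} {S : ℕ → ℤ} {K : ℤ}

theorem InputAt.le_left (hin : InputAt g n m A R S) : n ≤ A := by
  have := hin.count_le
  omega

/-- A box is needed here: without boxes the input has no matrix entries, and `m` may be exponential
in the input length. -/
theorem InputAt.le_right (hin : InputAt g n m A R S) (hn : 0 < n) : m ≤ A := by
  have h1 := hin.count_le
  have h2 : 1 * m ≤ n * m := Nat.mul_le_mul_right m hn
  omega

theorem InputAt.bounded_mem (hin : InputAt g n m A R S) {v : Vars} (hv : v.Bounded (lenBound A)) :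
    (mem g v).Bounded (lenBound A) :=
  hv.mem fun x => (hin.bounded x).trans (by have := le_lenBound A; omega)

theorem InputAt.len_index_le (hin : InputAt g n m A R S) {i : ℕ} (hi : i ≤ n + 4 * (n * m)) :
    len (i : ℤ) ≤ lenBound A := by
  have h1 := len_natCast_le i
  have h2 := hin.count_le
  have h3 := le_lenBound A
  omega

theorem numer_bound (hin : InputAt g n m A R S) (hK : len K ≤ A) {i k : ℕ} (hi : i < n) {d : ℕ}
    (hd : d ≤ m) : len (numer n m K R i k d) ≤ lenBound A := by
  have h1 := len_numer hin hK (k := k) hi hd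
  have h2 := hin.le_right (by omega)
  have : d * (16 * A) ≤ A * (16 * A) := Nat.mul_le_mul_right _ (hd.trans h2)
  unfold lenBound
  nlinarith

theorem denom_bound (hin : InputAt g n m A R S) (hK : len K ≤ A) {i k : ℕ} (hi : i < n) {d : ℕ}
    (hd : d ≤ m) : len (denom n m K R i k d) ≤ lenBound A := by
  have h1 := len_denom hin hK (k := k) hi hd
  have h2 := hin.le_right (by omega)
  have : d * (3 * A) ≤ A * (3 * A) := Nat.mul_le_mul_right _ (hd.trans h2)
  unfold lenBound
  nlinarith

theorem exec_sumP (hin : InputAt g n m A R S) {v : Vars} (hv : v.Bounded (lenBound A))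
    (hK : len v.K ≤ A) {i k : ℕ} (hi : v.i = i) (hi' : i < n) (hk : v.k = k) (hk' : k < m) :
    Exec A (lenBound A) sumP (mem g v) fun s => s = mem g { v with
      N := numer n m v.K R i k m, Q := denom n m v.K R i k m, j := m } := by
  have hA := le_lenBound A
  have hm := hin.le_right (by omega)
  have hidx : ∀ d ≤ m, len (d : ℤ) ≤ lenBound A := fun d hd => by
    have := len_natCast_le d
    omega
  have hstate : ∀ d ≤ m, ({ v with
      N := numer n m v.K R i k d, Q := denom n m v.K R i k d, j := d } : Vars).Bounded
        (lenBound A) := fun d hd =>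
    { hv with N := numer_bound hin hK hi' hd, Q := denom_bound hin hK hi' hd, j := hidx d hd }
  refine .seq (exec_N (hin.bounded_mem hv) ?_)
  have h0 : (Expr.sub (.const 0) (.mul (scaledE (.load (.const (-2))))
      (.mul (.load (.const (-1))) (.load (.const (-1)))))).eval (mem g v) = numer n m v.K R i k 0 := by
    have h2 : (Expr.load (.const (-2))).eval (mem g v) = i := by
      simp only [Expr.eval]
      exact hi
    have := eval_scaledE hin h2 (by omega)
    simp only [Expr.eval, this] at this ⊢
    simp only [numer, Finset.range_zero, Finset.sum_empty]
    rfl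
  rw [h0]
  refine .seq (exec_Q (hin.bounded_mem { hv with N := numer_bound hin hK hi' (Nat.zero_le _) }) ?_)
  refine .seq (exec_j (hin.bounded_mem { hv with
    N := numer_bound hin hK hi' (Nat.zero_le _)
    Q := denom_bound hin hK (k := k) hi' (Nat.zero_le _) }) ?_)
  refine Exec.loop m hm (fun d s => s = mem g { v with
    N := numer n m v.K R i k d, Q := denom n m v.K R i k d, j := d }) ?_ ?_ ?_
  · rintro d hd _ rfl
    refine ⟨hin.bounded_mem (hstate d hd), ?_⟩
    have h1 : mem g { v with N := numer n m v.K R i k d, Q := denom n m v.K R i k d, j := d } 1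
        = m := by rw [mem_of_nonneg _ _ (by norm_num), hin.one]
    have h2 : mem g { v with N := numer n m v.K R i k d, Q := denom n m v.K R i k d, j := d } (-4)
        = d := rfl
    simp only [Expr.eval, h1, h2]
    omega
  · rintro d hd _ rfl
    have hb := hstate d hd.le
    have hb' := hstate (d + 1) hd
    set w : Vars := { v with N := numer n m v.K R i k d, Q := denom n m v.K R i k d, j := d }
    have e1 : (valueE (.load (.const (-4)))).eval (mem g w) = value n m v.K R i d :=
      eval_valueE hin (v := w) rfl hi hi' hd
    have e2 : (valueE (.load (.const (-3)))).eval (mem g w) = value n m v.K R i k :=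
      eval_valueE hin (v := w) hk hi hi' hk'
    have hmid : Exec A (lenBound A) (.ite
        (.add (.sub (valueE (.load (.const (-4)))) (valueE (.load (.const (-3))))) (.const 1))
        (.seq
          (.assign (.const (-5)) (.add (.load (.const (-5)))
            (.mul (scaledE (entryE 0 (.load (.const (-4))))) (valueE (.load (.const (-4)))))))
          (.assign (.const (-6)) (.add (.load (.const (-6)))
            (scaledE (entryE 0 (.load (.const (-4))))))))
        .skip) (mem g w) fun s => s = mem g { v with
          N := numer n m v.K R i k (d + 1), Q := denom n m v.K R i k (d + 1), j := d } := by
      refine .ite (hin.bounded_mem hb) (fun ht => ?_) (fun ht => ?_)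
      · simp only [Expr.eval, e1, e2] at ht
        -- Between integers, the summand `1` in the test turns strict positivity into the weak
        -- inequality that defines the level set.
        have hle : value n m v.K R i k ≤ value n m v.K R i d := by omega
        have e3 : (Expr.add (.load (.const (-5))) (.mul (scaledE (entryE 0 (.load (.const (-4)))))
            (valueE (.load (.const (-4)))))).eval (mem g w) = numer n m v.K R i k (d + 1) := by
          have := eval_probE hin (v := w) (e := .load (.const (-4))) (j := d) rfl hi hi' hd
          simp only [Expr.eval, this, e1] at this ⊢
          change numer n m v.K R i k d + prob n m v.K R i d * value n m v.K R i d = _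
          simp only [numer, Finset.sum_range_succ, if_pos hle]
          ring
        refine .seq (exec_N (hin.bounded_mem hb) ?_)
        rw [e3]
        refine exec_Q (hin.bounded_mem { hb with N := hb'.N }) ?_
        have e4 : (Expr.add (.load (.const (-6))) (scaledE (entryE 0 (.load (.const (-4)))))).eval
            (mem g { w with N := numer n m v.K R i k (d + 1) }) = denom n m v.K R i k (d + 1) := by
          have := eval_probE hin (v := { w with N := numer n m v.K R i k (d + 1) })
            (e := .load (.const (-4))) (j := d) rfl hi hi' hd
          simp only [Expr.eval, this] at this ⊢
          change denom n m v.K R i k d + prob n m v.K R i d = _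
          simp only [denom, Finset.sum_range_succ, if_pos hle]
        rw [e4]
      · simp only [Expr.eval, e1, e2] at ht
        have hle : ¬ value n m v.K R i k ≤ value n m v.K R i d := by omega
        refine .skip (hin.bounded_mem hb).one_le ?_
        simp only [w, numer, denom, Finset.sum_range_succ, if_neg hle, add_zero]
    refine .seq (hmid.mono ?_)
    rintro _ rfl
    refine exec_j (hin.bounded_mem { hb' with j := hidx d hd.le }) ?_
    simp only [Expr.eval]
    rw [Nat.cast_succ]
    rfl
  · rfl

end exec

end SearchProgram

/-! ### Decoding the input -/

theorem getD_flatten_ofFn {n m : ℕ} (f : Fin n → Fin m → ℚ) (i : Fin n) (j : Fin m) (l : List ℚ) :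
    ((List.ofFn fun i => List.ofFn (f i)).flatten ++ l).getD (i * m + j) 0 = f i j := by
  induction n with
  | zero => exact i.elim0
  | succ n ih =>
    rw [List.ofFn_succ, List.flatten_cons, List.append_assoc]
    refine Fin.cases ?_ (fun i => ?_) i
    · rw [Fin.val_zero, zero_mul, zero_add, List.getD_append _ _ _ _ (by simp)]
      simp [List.getD_eq_getElem?_getD]
    · have : ((i.succ : Fin (n + 1)) : ℕ) * m + j = m + (i * m + j) := by
        rw [Fin.val_succ]; ring
      rw [this, List.getD_append_right _ _ _ _ (by simp)]
      simpa using ih (fun i => f i.succ) i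

theorem length_flatten_ofFn {n m : ℕ} (f : Fin n → Fin m → ℚ) :
    (List.ofFn fun i => List.ofFn (f i)).flatten.length = n * m := by
  simp [List.length_flatten, List.map_ofFn, Function.comp_def]

theorem getD_flatMap_ratCode (l : List ℚ) (l' : List ℤ) (q : ℕ) (hq : q < l.length) :
    (l.flatMap ratCode ++ l').getD (2 * q) 0 = (l.getD q 0).num ∧
    (l.flatMap ratCode ++ l').getD (2 * q + 1) 0 = (l.getD q 0).den := by
  induction l generalizing q with
  | nil => simp at hq
  | cons x l ih =>
    cases q with
    | zero => simp [ratCode]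
    | succ q =>
      have := ih q (by simpa using hq)
      rw [show 2 * (q + 1) = 2 * q + 1 + 1 by ring]
      simpa [ratCode] using this

theorem length_flatMap_ratCode (l : List ℚ) : (l.flatMap ratCode).length = 2 * l.length := by
  induction l with
  | nil => rfl
  | cons x l ih => simp only [List.flatMap_cons, List.length_append, ih, ratCode]; simp; ring

theorem matrixCode_eq {n m : ℕ} (x : Fin n → Fin m → ℚ) :
    matrixCode x = (List.ofFn fun i => List.ofFn (x i)).flatten.flatMap ratCode := by
  simp only [matrixCode, vectorCode, List.flatMap, List.map_flatten, List.flatten_flatten,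
    List.map_ofFn, Function.comp_def]

namespace RAM

theorem listSize_append (l l' : List ℤ) : listSize (l ++ l') = listSize l + listSize l' := by
  simp [listSize]

theorem len_le_listSize {l : List ℤ} {x : ℤ} (hx : x ∈ l) : len x ≤ listSize l :=
  List.single_le_sum (by simp) _ (List.mem_map_of_mem hx)

theorem length_le_listSize (l : List ℤ) : l.length ≤ listSize l := by
  induction l with
  | nil => simp
  | cons x l ih =>
    have := one_le_len x
    simp only [listSize, List.map_cons, List.sum_cons, List.length_cons] at *
    omega

/-- A nonnegative numerator is less than `2` to its size, so adding one stays within this power;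
sizes add up under products. -/
theorem natAbs_prod_le (l : List ℚ) (hl : ∀ x ∈ l, 0 ≤ x) :
    (l.map fun x => (x.num + 1) * (x.den : ℤ)).prod.natAbs ≤ 2 ^ listSize (l.flatMap ratCode) := by
  induction l with
  | nil => simp [listSize]
  | cons x l ih =>
    have h1 := ih fun y hy => hl y (List.mem_cons_of_mem _ hy)
    have h2 : ((x.num + 1) * (x.den : ℤ)).natAbs ≤ 2 ^ listSize (ratCode x) := by
      have hx := Rat.num_nonneg.2 (hl x List.mem_cons_self)
      have a1 := natAbs_lt_two_pow_len x.num
      have a2 := natAbs_lt_two_pow_len x.den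
      have a3 : listSize (ratCode x) = x.num.natAbs.size + (x.den : ℤ).natAbs.size + 2 := by
        simp only [listSize, ratCode, len, List.map_cons, List.map_nil, List.sum_cons, List.sum_nil]
        ring
      rw [Int.natAbs_mul, a3, add_assoc, pow_add]
      refine Nat.mul_le_mul (by omega) (a2.le.trans (Nat.pow_le_pow_right (by norm_num) (by omega)))
    rw [List.map_cons, List.prod_cons, List.flatMap_cons, listSize_append, pow_add, Int.natAbs_mul]
    exact Nat.mul_le_mul h2 h1

theorem memoryOf_natCast (l : List ℤ) (k : ℕ) : memoryOf l k = l.getD k 0 := by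
  simp [memoryOf]

end RAM

namespace SearchProblem

variable {n m : ℕ}

theorem inputCode_eq (I : SearchProblem n m) (T : Contract I) :
    inputCode I T = (n : ℤ) :: (m : ℤ) :: (I.inputRats T).flatMap ratCode := by
  simp only [inputCode, inputRats, matrixCode_eq, List.flatMap_append, List.append_assoc,
    List.cons_append, List.nil_append]
  simp only [vectorCode, List.flatMap, List.map_ofFn]
  rfl

theorem length_inputRats (I : SearchProblem n m) (T : Contract I) :
    (I.inputRats T).length = n + 4 * (n * m) := by
  simp only [inputRats, List.length_append, length_flatten_ofFn, List.length_ofFn]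
  ring

/-- The rational number with index `q` in the input. -/
def inputRat (I : SearchProblem n m) (T : Contract I) (q : ℕ) : ℚ := (I.inputRats T).getD q 0

variable (I : SearchProblem n m) (T : Contract I) (i : Fin n) (j : Fin m)

theorem inputRat_c : I.inputRat T i = I.c i := by
  simp only [inputRat, inputRats, List.append_assoc]
  rw [List.getD_append _ _ _ _ (by simp)]
  simp [List.getD_eq_getElem?_getD]

theorem inputRat_p : I.inputRat T (n + 0 * (n * m) + (i * m + j)) = I.p i j := by
  simp only [inputRat, inputRats, List.append_assoc]
  rw [List.getD_append_right _ _ _ _ (by simp)]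
  rw [show n + 0 * (n * m) + (i * m + j) - (List.ofFn I.c).length = i * m + j by simp]
  exact getD_flatten_ofFn _ _ _ _

theorem inputRat_a : I.inputRat T (n + 1 * (n * m) + (i * m + j)) = I.a i j := by
  simp only [inputRat, inputRats, List.append_assoc]
  rw [List.getD_append_right _ _ _ _ (by rw [List.length_ofFn]; omega), List.length_ofFn,
    List.getD_append_right _ _ _ _ (by rw [length_flatten_ofFn]; omega), length_flatten_ofFn]
  rw [show n + 1 * (n * m) + (i * m + j) - n - n * m = i * m + j by omega]
  exact getD_flatten_ofFn _ _ _ _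

theorem inputRat_b : I.inputRat T (n + 2 * (n * m) + (i * m + j)) = I.b i j := by
  simp only [inputRat, inputRats, List.append_assoc]
  rw [List.getD_append_right _ _ _ _ (by rw [List.length_ofFn]; omega), List.length_ofFn,
    List.getD_append_right _ _ _ _ (by rw [length_flatten_ofFn]; omega), length_flatten_ofFn,
    List.getD_append_right _ _ _ _ (by rw [length_flatten_ofFn]; omega), length_flatten_ofFn]
  rw [show n + 2 * (n * m) + (i * m + j) - n - n * m - n * m = i * m + j by omega]
  exact getD_flatten_ofFn _ _ _ _

theorem inputRat_t : I.inputRat T (n + 3 * (n * m) + (i * m + j)) = T.t i j := by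
  simp only [inputRat, inputRats, List.append_assoc]
  rw [List.getD_append_right _ _ _ _ (by rw [List.length_ofFn]; omega), List.length_ofFn,
    List.getD_append_right _ _ _ _ (by rw [length_flatten_ofFn]; omega), length_flatten_ofFn,
    List.getD_append_right _ _ _ _ (by rw [length_flatten_ofFn]; omega), length_flatten_ofFn,
    List.getD_append_right _ _ _ _ (by rw [length_flatten_ofFn]; omega), length_flatten_ofFn]
  rw [show n + 3 * (n * m) + (i * m + j) - n - n * m - n * m - n * m = i * m + j by omega,
    ← List.append_nil (List.flatten _)]
  exact getD_flatten_ofFn _ _ _ _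

end SearchProblem

/-! ### Scaled integers and the rational numbers they represent -/

namespace SearchProgram

open RAM

variable {n m : ℕ} (I : SearchProblem n m) (T : Contract I) (σ : Situation n m)

/-- The entry of the situation that belongs to box `i`. -/
def situationEntry (i : ℕ) : ℤ := (situationCode σ).getD i 0

theorem situationEntry_eq (i : Fin n) :
    situationEntry σ i = match σ i with
      | none => 0
      | some j => (j : ℤ) + 1 := by
  simp only [situationEntry, situationCode, List.getD_eq_getElem?_getD]
  cases h : σ i <;> simp [h]

theorem inputAt : InputAt (memoryOf (inputCode I T ++ situationCode σ)) n m
    (listSize (inputCode I T)) (I.inputRat T) (situationEntry σ) := by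
  have hmem : ∀ k : ℕ, memoryOf (inputCode I T ++ situationCode σ) ((2 + k : ℕ) : ℤ)
      = ((I.inputRats T).flatMap ratCode ++ situationCode σ).getD k 0 := fun k => by
    rw [memoryOf_natCast, I.inputCode_eq, add_comm]
    rfl
  have hlen := I.length_inputRats T
  have hm : len m ≤ listSize (inputCode I T) := len_le_listSize (by rw [I.inputCode_eq]; simp)
  refine ⟨?_, ?_, fun q hq => ?_, fun q hq => ?_, fun i hi => ?_, fun x => ?_, ?_⟩
  · have := memoryOf_natCast (inputCode I T ++ situationCode σ) 0
    rw [I.inputCode_eq] at this ⊢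
    exact this
  · have := memoryOf_natCast (inputCode I T ++ situationCode σ) 1
    rw [I.inputCode_eq] at this ⊢
    exact this
  · have := hmem (2 * q)
    rw [(getD_flatMap_ratCode _ _ q (by omega)).1] at this
    exact_mod_cast this
  · have := hmem (2 * q + 1)
    rw [(getD_flatMap_ratCode _ _ q (by omega)).2] at this
    rw [show (3 + 2 * q : ℤ) = ((2 + (2 * q + 1) : ℕ) : ℤ) by push_cast; ring]
    exact this
  · have := hmem (2 * (n + 4 * (n * m)) + i)
    rw [List.getD_append_right _ _ _ _ (by rw [length_flatMap_ratCode]; omega),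
      length_flatMap_ratCode, hlen, Nat.add_sub_cancel_left] at this
    rw [situationEntry, ← this]
    push_cast
    ring_nf
  · unfold memoryOf
    have h0 : len 0 ≤ listSize (inputCode I T) := by
      refine le_trans ?_ hm
      exact len_mono (by simp)
    split_ifs
    · rw [List.getD_eq_getElem?_getD]
      cases h : (inputCode I T ++ situationCode σ)[x.toNat]? with
      | none => exact h0
      | some y =>
        rcases List.mem_append.1 (List.mem_of_getElem? h) with hy | hy
        · exact len_le_listSize hy
        · obtain ⟨i, rfl⟩ := (List.mem_ofFn' _ _).1 hy
          -- An entry of the situation is at most `m`, which is itself part of the instance; so the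
          -- bound need not involve the situation.
          refine le_trans (len_mono ?_) hm
          simp only [Option.getD_some]
          split <;> omega
    · exact h0
  · have := length_le_listSize (inputCode I T)
    rw [I.inputCode_eq] at this ⊢
    simp only [List.length_cons, length_flatMap_ratCode, hlen] at this
    omega

/-- Prefixes are needed because `K` is built up factor by factor. The estimate by a power of two
exceeds the code of the rationals by two symbols, paid for by the entries `n` and `m`. -/
theorem len_prod_take (q : ℕ) :
    len (((I.inputRats T).take q).map fun x => (x.num + 1) * (x.den : ℤ)).prod
      ≤ listSize (inputCode I T) := by
  have h1 := natAbs_prod_le ((I.inputRats T).take q)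
    fun x hx => I.inputRats_nonneg T x (List.mem_of_mem_take hx)
  have h2 := len_le_of_natAbs_lt (h1.trans_lt (Nat.pow_lt_pow_right (by norm_num) (Nat.lt_succ_self _)))
  have h3 : listSize (inputCode I T) = len n + len m + (listSize (((I.inputRats T).take q).flatMap ratCode) +
      listSize (((I.inputRats T).drop q).flatMap ratCode)) := by
    rw [← listSize_append, ← List.flatMap_append, List.take_append_drop, I.inputCode_eq]
    simp only [listSize, List.map_cons, List.sum_cons]
    ring
  have h4 := one_le_len n
  have h5 := one_le_len m
  omega

theorem len_scale : len (I.scale T) ≤ listSize (inputCode I T) := by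
  have := len_prod_take I T (I.inputRats T).length
  rwa [List.take_length] at this

/-- The integer division is exact because the scale is divisible by every denominator in the input.
-/
theorem scaled_cast {x : ℚ} (hx : x ∈ I.inputRats T) :
    ((scaled (I.scale T) x : ℤ) : ℚ) = I.scale T * x := by
  obtain ⟨e, he⟩ := I.den_dvd_scale T hx
  have hd : (x.den : ℤ) ≠ 0 := by exact_mod_cast x.den_ne_zero
  rw [scaled, he, mul_assoc, Int.mul_ediv_cancel_left _ hd]
  push_cast
  rw [← Rat.den_mul_eq_num x]
  ring

theorem inputRat_mem {q : ℕ} (hq : q < n + 4 * (n * m)) : I.inputRat T q ∈ I.inputRats T := by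
  rw [← I.length_inputRats T] at hq
  rw [SearchProblem.inputRat, List.getD_eq_getElem _ _ hq]
  exact List.getElem_mem hq

theorem prob_cast (i : Fin n) (j : Fin m) :
    ((prob n m (I.scale T) (I.inputRat T) i j : ℤ) : ℚ) = I.scale T * I.p i j := by
  rw [prob, scaled_cast I T (inputRat_mem I T (entry_lt i.2 j.2 (by norm_num))), I.inputRat_p]

/-- One factor of the scale clears the denominators of the input, the other one clears the inverse
scale in the perturbation. -/
theorem value_cast (i : Fin n) (j : Fin m) :
    ((value n m (I.scale T) (I.inputRat T) i j : ℤ) : ℚ)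
      = I.scale T ^ 2 * I.perturbedValue T i j := by
  have hK : (I.scale T : ℚ) ≠ 0 := by exact_mod_cast (I.scale_pos T).ne'
  rw [value]
  push_cast
  rw [scaled_cast I T (inputRat_mem I T (entry_lt i.2 j.2 (by norm_num))),
    scaled_cast I T (inputRat_mem I T (entry_lt i.2 j.2 (by norm_num))),
    scaled_cast I T (inputRat_mem I T (entry_lt i.2 j.2 (by norm_num))),
    I.inputRat_a, I.inputRat_b, I.inputRat_t, SearchProblem.perturbedValue]
  field_simp

theorem value_le_value (i : Fin n) (k j : Fin m) :
    value n m (I.scale T) (I.inputRat T) i k ≤ value n m (I.scale T) (I.inputRat T) i j ↔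
      I.perturbedValue T i k ≤ I.perturbedValue T i j := by
  have hK : (0 : ℚ) < I.scale T ^ 2 := by
    have : (0 : ℚ) < I.scale T := by exact_mod_cast I.scale_pos T
    positivity
  rw [← mul_le_mul_iff_right₀ hK, ← value_cast, ← value_cast, Int.cast_le]

/-- Numerators carry the third power of the scale and denominators the first, so fractions are
scaled by its square, exactly like the values of opened boxes. -/
theorem numer_cast (i : Fin n) (k : Fin m) :
    ((numer n m (I.scale T) (I.inputRat T) i k m : ℤ) : ℚ) = I.scale T * I.scale T ^ 2 *
      ((∑ j, if I.perturbedValue T i k ≤ I.perturbedValue T i j then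
        I.p i j * I.perturbedValue T i j else 0) - I.c i) := by
  have hc := scaled_cast I T (inputRat_mem I T (by have := i.2; omega : (i : ℕ) < n + 4 * (n * m)))
  rw [I.inputRat_c] at hc
  rw [numer, Finset.sum_range]
  simp only [value_le_value, I.inputRat_c]
  push_cast
  rw [hc, mul_sub, Finset.mul_sum]
  congr 1
  · refine Finset.sum_congr rfl fun j _ => ?_
    split_ifs
    · rw [prob_cast, value_cast]; ring
    · simp
  · ring

theorem denom_cast (i : Fin n) (k : Fin m) :
    ((denom n m (I.scale T) (I.inputRat T) i k m : ℤ) : ℚ) = I.scale T *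
      ∑ j, if I.perturbedValue T i k ≤ I.perturbedValue T i j then I.p i j else 0 := by
  rw [denom, Finset.sum_range]
  simp only [value_le_value]
  push_cast
  rw [Finset.mul_sum]
  refine Finset.sum_congr rfl fun j _ => ?_
  split_ifs
  · rw [prob_cast]
  · simp

end SearchProgram

/-! ### The search for the best move -/

namespace SearchProgram

open RAM

variable {n m : ℕ}

/-- A move that is at least as good as the value `y`. -/
def Achieves (x : Fin n → Fin m → ℚ) (r : Fin n → ℚ) (σ : Situation n m) (y : ℚ) : Move n → Prop
  | Move.openBox i => σ i = none ∧ y ≤ r i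
  | Move.takePrize i => σ i ≠ none ∧ y ≤ SearchProblem.score x r σ i
  | Move.quit => y ≤ 0

theorem Achieves.isGreedyMove {x : Fin n → Fin m → ℚ} {r : Fin n → ℚ} {σ : Situation n m} {y : ℚ}
    {mv : Move n} (h : Achieves x r σ y mv) (h0 : 0 ≤ y)
    (hy : ∀ i, SearchProblem.score x r σ i ≤ y) : SearchProblem.IsGreedyMove x r σ mv := by
  cases mv with
  | openBox i => exact ⟨h.1, h0.trans h.2, fun i' => (hy i').trans h.2⟩
  | takePrize i => exact ⟨h.1, h0.trans h.2, fun i' => (hy i').trans h.2⟩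
  | quit => exact fun i' => (hy i').trans h

/-- The variables hold the code of a move that achieves the value `BN / (BD * L)`, which
satisfies `Done`. -/
def Tracks (ach : ℚ → Move n → Prop) (L : ℚ) (v : Vars) (Done : ℚ → Prop) : Prop :=
  ∃ mv y, v.BM = moveCode mv ∧ 0 < v.BD ∧ (v.BN : ℚ) = y * (v.BD * L) ∧ 0 ≤ y ∧ ach y mv ∧ Done y

/-- The variables after the execution of `compareP`. -/
def compared (v : Vars) (z : ℤ) : Vars :=
  if v.BN * v.Q < v.N * v.BD then { v with BN := v.N, BD := v.Q, BM := z } else v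

/-- The cross-multiplied test differs from `y * ρ < ν` by the positive factor `κ * L * BD`. If `ρ =
0`, then `ν ≤ 0` excludes a replacement, so `BD` stays positive. A replacement only increases `y`,
which preserves `Done`. -/
theorem Tracks.compared {ach : ℚ → Move n → Prop} {L : ℚ} {v : Vars} {Done : ℚ → Prop}
    (h : Tracks ach L v Done) (hL : 0 < L) (hDone : ∀ y y', y ≤ y' → Done y → Done y')
    {ν ρ κ : ℚ} (hκ : 0 < κ) (hN : (v.N : ℚ) = κ * L * ν) (hQ : (v.Q : ℚ) = κ * ρ) (hρ : 0 ≤ ρ)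
    (h0 : ρ = 0 → ν ≤ 0) {mv : Move n} (hach : ∀ y, 0 < ρ → ν = y * ρ → ach y mv) :
    Tracks ach L (compared v (moveCode mv)) fun y => Done y ∧ ν ≤ y * ρ := by
  obtain ⟨mv', y, h1, h2, h3, h4, h5, h6⟩ := h
  have hBD : (0 : ℚ) < v.BD := by exact_mod_cast h2
  have hpos : 0 < κ * L * v.BD := by positivity
  have key : v.BN * v.Q < v.N * v.BD ↔ y * ρ < ν := by
    rw [← Int.cast_lt (R := ℚ), Int.cast_mul, Int.cast_mul, h3, hN, hQ]
    rw [show y * (v.BD * L) * (κ * ρ) = κ * L * v.BD * (y * ρ) by ring,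
      show κ * L * ν * v.BD = κ * L * v.BD * ν by ring]
    exact mul_lt_mul_iff_right₀ hpos
  unfold SearchProgram.compared
  split_ifs with hc
  · have hlt := key.1 hc
    have hρ' : 0 < ρ := by
      rcases hρ.lt_or_eq with h | h
      · exact h
      · have := h0 h.symm
        rw [← h, mul_zero] at hlt
        exact absurd hlt (not_lt.2 this)
    have hy : y ≤ ν / ρ := ((lt_div_iff₀ hρ').2 hlt).le
    have hν : ν = ν / ρ * ρ := (div_mul_cancel₀ _ hρ'.ne').symm
    refine ⟨mv, ν / ρ, rfl, ?_, ?_, h4.trans hy, hach _ hρ' hν, hDone _ _ hy h6, hν.le⟩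
    · have : (0 : ℚ) < v.Q := by rw [hQ]; positivity
      exact_mod_cast this
    · change (v.N : ℚ) = ν / ρ * (v.Q * L)
      rw [hN, hQ]
      field_simp
  · exact ⟨mv', y, h1, h2, h3, h4, h5, h6, not_lt.1 fun h => hc (key.2 h)⟩

theorem compared_frame (v : Vars) (z : ℤ) : (compared v z).K = v.K ∧ (compared v z).i = v.i ∧
    (compared v z).k = v.k := by
  unfold compared
  split_ifs <;> exact ⟨rfl, rfl, rfl⟩

theorem compared_bounded {v : Vars} {z : ℤ} {B : ℕ} (hv : v.Bounded B) (hz : len z ≤ B) :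
    (compared v z).Bounded B := by
  unfold compared
  split_ifs
  · exact { hv with BN := hv.N, BD := hv.Q, BM := hz }
  · exact hv

theorem exec_compareP {g : Memory} {v : Vars} {T B : ℕ} (hg : g.Bounded B) (hv : v.Bounded B)
    {code : Expr} {z : ℤ} (hz : ∀ w : Vars, w.i = v.i → code.eval (mem g w) = z) :
    Exec T B (compareP code) (mem g v) fun s => s = mem g (compared v z) := by
  have ht : (Expr.sub (.mul (.load (.const (-5))) (.load (.const (-8))))
      (.mul (.load (.const (-7))) (.load (.const (-6))))).eval (mem g v)
      = v.N * v.BD - v.BN * v.Q := by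
    simp only [Expr.eval]
    rfl
  refine .ite (hv.mem hg) (fun h => ?_) (fun h => ?_) <;> rw [ht] at h
  · have e1 : (Expr.load (.const (-5))).eval (mem g v) = v.N := by simp only [Expr.eval]; rfl
    refine .seq (exec_BN (hv.mem hg) ?_)
    rw [e1]
    have e2 : (Expr.load (.const (-6))).eval (mem g { v with BN := v.N }) = v.Q := by
      simp only [Expr.eval]; rfl
    have hv1 : ({ v with BN := v.N } : Vars).Bounded B := { hv with BN := hv.N }
    refine .seq (exec_BD (hv1.mem hg) ?_)
    rw [e2]
    have hv2 : ({ v with BN := v.N, BD := v.Q } : Vars).Bounded B :=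
      { hv with BN := hv.N, BD := hv.Q }
    refine exec_BM (hv2.mem hg) ?_
    have e3 : code.eval (mem g { v with BN := v.N, BD := v.Q }) = z := hz _ rfl
    rw [e3, compared, if_pos (by omega)]
  · refine .skip (hv.mem hg).one_le ?_
    rw [compared, if_neg (by omega)]

section

variable (I : SearchProblem n m) (T : Contract I) (σ : Situation n m) {r : Fin n → ℚ}

/-- The memory in which the program is started. -/
def input : Memory := memoryOf (inputCode I T ++ situationCode σ)

/-- The encoding length of the instance and the contract. -/
def size : ℕ := listSize (inputCode I T)

theorem input_spec : InputAt (input I T σ) n m (size I T) (I.inputRat T) (situationEntry σ) :=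
  inputAt I T σ

theorem input_bounded : (input I T σ).Bounded (lenBound (size I T)) := fun x =>
  ((input_spec I T σ).bounded x).trans (by have := le_lenBound (size I T); omega)

theorem scale_pow_pos : (0 : ℚ) < I.scale T ^ 2 := by
  have : (0 : ℚ) < I.scale T := by exact_mod_cast I.scale_pos T
  positivity

/-- The loop invariant of the search for the best move. -/
def Invariant (r : Fin n → ℚ) (i : ℕ) (Done : ℚ → Prop) (v : Vars) : Prop :=
  v.K = I.scale T ∧ v.i = i ∧ v.Bounded (lenBound (size I T)) ∧
    Tracks (Achieves (I.perturbedValue T) r σ) (I.scale T ^ 2) v Done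

theorem len_code_le (i : Fin n) : len ((i : ℤ) + 1) ≤ lenBound (size I T) := by
  have := (input_spec I T fun _ => none).len_index_le (i := i + 1) (by have := i.2; omega)
  exact_mod_cast this

theorem exec_openedP (i : Fin n) (j : Fin m) (hj : σ i = some j) {Done : ℚ → Prop}
    (hDone : ∀ y y', y ≤ y' → Done y → Done y') {v : Vars} (hv : Invariant I T σ r i Done v) :
    Exec (size I T) (lenBound (size I T)) openedP (mem (input I T σ) v) fun s =>
      ∃ v', s = mem (input I T σ) v' ∧ Invariant I T σ r i
        (fun y => Done y ∧ SearchProblem.score (I.perturbedValue T) r σ i ≤ y) v' := by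
  obtain ⟨hK, hi, hb, ht⟩ := hv
  have hin := input_spec I T σ
  have hg := input_bounded I T σ
  have hA := le_lenBound (size I T)
  have hscore : SearchProblem.score (I.perturbedValue T) r σ i = I.perturbedValue T i j := by
    simp [SearchProblem.score, hj]
  have e1 : (valueE (.sub situationE (.const 1))).eval (mem (input I T σ) v)
      = value n m (I.scale T) (I.inputRat T) i j := by
    rw [← hK]
    refine eval_valueE hin ?_ hi i.2 j.2
    simp only [Expr.eval, eval_situationE hin hi i.2, situationEntry_eq, hj]
    ring
  refine .seq (exec_N (hb.mem hg) ?_)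
  rw [e1]
  have hN : len (value n m (I.scale T) (I.inputRat T) i j) ≤ lenBound (size I T) :=
    (len_value hin (len_scale I T) i.2 j.2).trans (by omega)
  have hb1 : ({ v with N := value n m (I.scale T) (I.inputRat T) i j } : Vars).Bounded
      (lenBound (size I T)) := { hb with N := hN }
  refine .seq (exec_Q (hb1.mem hg) ?_)
  have hQ : len 1 ≤ lenBound (size I T) := le_trans (by decide : len 1 ≤ 84) (by omega)
  have hb2 : ({ v with N := value n m (I.scale T) (I.inputRat T) i j, Q := 1 } : Vars).Bounded
      (lenBound (size I T)) := { hb with N := hN, Q := hQ }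
  simp only [Expr.eval]
  refine (exec_compareP hg hb2 (z := moveCode (.takePrize i)) fun w hw => ?_).mono ?_
  · have : mem (input I T σ) w (-2) = i := hw.trans hi
    simp only [Expr.eval, this, moveCode]
    ring
  · rintro _ rfl
    refine ⟨_, rfl, (compared_frame _ _).1.trans hK, (compared_frame _ _).2.1.trans hi,
      compared_bounded hb2 ?_, ?_⟩
    · rw [moveCode, len_neg]
      exact len_code_le I T i
    · have ht2 : Tracks (Achieves (I.perturbedValue T) r σ) (I.scale T ^ 2)
          { v with N := value n m (I.scale T) (I.inputRat T) i j, Q := 1 } Done := ht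
      -- An opened box is the fraction with denominator `1`; its value already carries the factor
      -- `L`, hence `κ = 1`.
      have := ht2.compared (scale_pow_pos I T) hDone (ν := I.perturbedValue T i j) (ρ := 1) (κ := 1)
        one_pos (by rw [one_mul]; exact value_cast I T i j) (by simp) zero_le_one (by simp)
        (mv := .takePrize i)
        fun y _ hy => ⟨by simp [hj], by rw [hscore, hy, mul_one]⟩
      simpa only [mul_one, hscore] using this

/-- No reservation value is computed in isolation: the fractions of all prizes compete with the best
move so far. Each fraction with positive denominator is at most `r i`, so opening the box achieves
it; and by `hr` a value that dominates all fractions dominates `r i`. -/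
theorem exec_closedP (i : Fin n) (hi' : σ i = none)
    (hr : ∀ y, r i ≤ y ↔ ∀ k, (∑ j, if I.perturbedValue T i k ≤ I.perturbedValue T i j then
        I.p i j * I.perturbedValue T i j else 0) - I.c i
      ≤ y * ∑ j, if I.perturbedValue T i k ≤ I.perturbedValue T i j then I.p i j else 0)
    {Done : ℚ → Prop} (hDone : ∀ y y', y ≤ y' → Done y → Done y') {v : Vars}
    (hv : Invariant I T σ r i Done v) :
    Exec (size I T) (lenBound (size I T)) closedP (mem (input I T σ) v) fun s =>
      ∃ v', s = mem (input I T σ) v' ∧ Invariant I T σ r i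
        (fun y => Done y ∧ SearchProblem.score (I.perturbedValue T) r σ i ≤ y) v' := by
  obtain ⟨hK, hi, hb, ht⟩ := hv
  have hin := input_spec I T σ
  have hg := input_bounded I T σ
  have hA := le_lenBound (size I T)
  have hm := hin.le_right (Nat.zero_lt_of_lt i.2)
  have hidx : ∀ d ≤ m, len (d : ℤ) ≤ lenBound (size I T) := fun d hd => by
    have := len_natCast_le d
    omega
  set ν : Fin m → ℚ := fun k => (∑ j, if I.perturbedValue T i k ≤ I.perturbedValue T i j then
        I.p i j * I.perturbedValue T i j else 0) - I.c i with hν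
  set ρ : Fin m → ℚ := fun k =>
    ∑ j, if I.perturbedValue T i k ≤ I.perturbedValue T i j then I.p i j else 0 with hρ
  have hscore : SearchProblem.score (I.perturbedValue T) r σ i = r i := by
    simp [SearchProblem.score, hi']
  have hnn : ∀ k j, 0 ≤ if I.perturbedValue T i k ≤ I.perturbedValue T i j then I.p i j else 0 :=
    fun k j => by split_ifs; exacts [I.p_nonneg i j, le_rfl]
  -- This is the criterion `hr` at `y = r i`, where it holds trivially.
  have hρ0 : ∀ k, ρ k = 0 → ν k ≤ 0 := by
    intro k hk
    have := (hr (r i)).1 le_rfl k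
    change ν k ≤ r i * ρ k at this
    rwa [hk, mul_zero] at this
  refine .seq (exec_k (hb.mem hg) ?_)
  refine (Exec.loop m hm (fun d s => ∃ v', s = mem (input I T σ) v' ∧ v'.k = d ∧
    Invariant I T σ r i (fun y => Done y ∧ ∀ k : Fin m, (k : ℕ) < d → ν k ≤ y * ρ k) v')
    ?_ ?_ ?_).mono ?_
  · rintro d hd _ ⟨w, rfl, hwk, hwK, hwi, hwb, hwt⟩
    refine ⟨hwb.mem hg, ?_⟩
    have h1 : mem (input I T σ) w 1 = m := by rw [mem_of_nonneg _ _ (by norm_num), hin.one]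
    have h2 : mem (input I T σ) w (-3) = d := hwk
    simp only [Expr.eval, h1, h2]
    omega
  · rintro d hd _ ⟨w, rfl, hwk, hwK, hwi, hwb, hwt⟩
    refine .seq ((exec_sumP hin hwb (hwK ▸ len_scale I T) hwi i.2 hwk hd).mono ?_)
    rintro _ rfl
    rw [hwK]
    set w₁ : Vars := { w with
      K := I.scale T
      N := numer n m (I.scale T) (I.inputRat T) i d m
      Q := denom n m (I.scale T) (I.inputRat T) i d m
      j := m } with hw₁
    have hb1 : w₁.Bounded (lenBound (size I T)) :=
      { hwb with
        K := (congrArg len hwK).symm.trans_le hwb.K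
        N := numer_bound hin (len_scale I T) i.2 le_rfl
        Q := denom_bound hin (len_scale I T) i.2 le_rfl
        j := hidx m le_rfl }
    refine .seq ((exec_compareP hg hb1 (z := moveCode (.openBox i)) fun w' hw' => ?_).mono ?_)
    · have : mem (input I T σ) w' (-2) = i := hw'.trans hwi
      simp only [Expr.eval, this, moveCode]
    · rintro _ rfl
      have hb2 : (compared w₁ (moveCode (.openBox i))).Bounded (lenBound (size I T)) :=
        compared_bounded hb1 (len_code_le I T i)
      refine exec_k (hb2.mem hg) ⟨_, rfl, ?_, ?_, ?_, ?_, ?_⟩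
      · have : mem (input I T σ) (compared w₁ (moveCode (.openBox i))) (-3) = d :=
          (compared_frame w₁ (moveCode (.openBox i))).2.2.trans hwk
        simp only [Expr.eval, this, Nat.cast_succ]
      · exact (compared_frame _ _).1
      · exact (compared_frame _ _).2.1.trans hwi
      · have : mem (input I T σ) (compared w₁ (moveCode (.openBox i))) (-3) = d :=
          (compared_frame w₁ (moveCode (.openBox i))).2.2.trans hwk
        refine { hb2 with k := ?_ }
        simp only [Expr.eval, this]
        exact_mod_cast hidx (d + 1) hd
      · have ht1 : Tracks (Achieves (I.perturbedValue T) r σ) (I.scale T ^ 2) w₁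
            (fun y => Done y ∧ ∀ k : Fin m, (k : ℕ) < d → ν k ≤ y * ρ k) := hwt
        have hκ : (0 : ℚ) < I.scale T := by exact_mod_cast I.scale_pos T
        have ht2 := ht1.compared (scale_pow_pos I T)
          (fun y y' hy h => ⟨hDone y y' hy h.1, fun k hk => (h.2 k hk).trans
            (mul_le_mul_of_nonneg_right hy (Finset.sum_nonneg fun j _ => hnn k j))⟩)
          (ν := ν ⟨d, hd⟩) (ρ := ρ ⟨d, hd⟩) hκ (numer_cast I T i ⟨d, hd⟩) (denom_cast I T i ⟨d, hd⟩)
          (Finset.sum_nonneg fun j _ => hnn _ j) (hρ0 _) (mv := .openBox i)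
          fun y hpos hy => ⟨hi', by
            have := (hr (r i)).1 le_rfl ⟨d, hd⟩
            change ν ⟨d, hd⟩ ≤ r i * ρ ⟨d, hd⟩ at this
            rw [hy] at this
            exact le_of_mul_le_mul_right this hpos⟩
        obtain ⟨mv, y, a1, a2, a3, a4, a5, ⟨a6, a7⟩, a8⟩ := ht2
        refine ⟨mv, y, a1, a2, a3, a4, a5, a6, fun k hk => ?_⟩
        rcases Nat.lt_succ_iff_lt_or_eq.1 hk with h | h
        · exact a7 k h
        · rwa [show k = ⟨d, hd⟩ from Fin.ext h]
  · refine ⟨_, rfl, by simp [Expr.eval], hK, hi,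
      { hb with k := ?_ }, ?_⟩
    · simp only [Expr.eval]
      exact_mod_cast hidx 0 (Nat.zero_le _)
    · obtain ⟨mv, y, a1, a2, a3, a4, a5, a6⟩ := ht
      exact ⟨mv, y, a1, a2, a3, a4, a5, a6, fun k hk => absurd hk (Nat.not_lt_zero _)⟩
  · rintro _ ⟨w, rfl, -, hwK, hwi, hwb, mv, y, a1, a2, a3, a4, a5, a6, a7⟩
    refine ⟨w, rfl, hwK, hwi, hwb, mv, y, a1, a2, a3, a4, a5, a6, ?_⟩
    rw [hscore, hr]
    exact fun k => a7 k k.2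

/-- The program does not initialize its counter `i` but relies on the zero in the initial memory,
hence `hi`. -/
theorem exec_scaleP {v : Vars} (hv : v.Bounded (lenBound (size I T))) (hi : v.i = 0) :
    Exec (size I T) (lenBound (size I T)) scaleP (mem (input I T σ) v) fun s =>
      s = mem (input I T σ) { v with K := I.scale T, i := ((n + 4 * (n * m) : ℕ) : ℤ) } := by
  have hin := input_spec I T σ
  have hg := input_bounded I T σ
  have hA := le_lenBound (size I T)
  have hl := I.length_inputRats T
  set K : ℕ → ℤ := fun q =>
    (((I.inputRats T).take q).map fun x => (x.num + 1) * (x.den : ℤ)).prod with hKdef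
  have hKlen : ∀ q, len (K q) ≤ lenBound (size I T) := fun q =>
    (len_prod_take I T q).trans (by unfold size at hA; unfold size; omega)
  have hb : ∀ q ≤ n + 4 * (n * m), ({ v with K := K q, i := q } : Vars).Bounded
      (lenBound (size I T)) := fun q hq => { hv with K := hKlen q, i := hin.len_index_le hq }
  refine .seq (exec_K (hv.mem hg) ?_)
  refine (Exec.loop (n + 4 * (n * m)) hin.count_le
    (fun q s => s = mem (input I T σ) { v with K := K q, i := q }) ?_ ?_ ?_).mono ?_
  · rintro q hq _ rfl
    refine ⟨(hb q hq).mem hg, ?_⟩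
    have h2 : mem (input I T σ) { v with K := K q, i := q } (-2) = q := rfl
    simp only [Expr.eval, eval_countE hin, h2]
    omega
  · rintro q hq _ rfl
    set w : Vars := { v with K := K q, i := q } with hw
    have h1 : mem (input I T σ) w (-1) = K q := rfl
    have h2 : mem (input I T σ) w (-2) = q := rfl
    have h3 : mem (input I T σ) w (2 + 2 * q) = (I.inputRat T q).num := by
      rw [mem_of_nonneg _ _ (by positivity), hin.num q hq]
    have h4 : mem (input I T σ) w (3 + 2 * q) = (I.inputRat T q).den := by
      rw [mem_of_nonneg _ _ (by positivity), hin.den q hq]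
    refine .seq (exec_K ((hb q hq.le).mem hg) ?_)
    simp only [Expr.eval, h1, h2, h3, h4]
    have hKs : K q * (((I.inputRat T q).num + 1) * (I.inputRat T q).den) = K (q + 1) := by
      have hq' : q < (I.inputRats T).length := by omega
      simp only [hKdef, List.map_take]
      rw [List.prod_take_succ _ _ (by simpa using hq'), List.getElem_map, SearchProblem.inputRat,
        List.getD_eq_getElem _ _ hq']
    rw [hKs]
    have hb1 : ({ w with K := K (q + 1) } : Vars).Bounded (lenBound (size I T)) :=
      { hb q hq.le with K := hKlen _ }
    refine exec_i (hb1.mem hg) ?_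
    have h5 : mem (input I T σ) { w with K := K (q + 1) } (-2) = q := rfl
    simp only [Expr.eval, h5, Nat.cast_succ]
    rfl
  · simp [Expr.eval, hKdef, hi]
  · rintro _ rfl
    have : K (n + 4 * (n * m)) = I.scale T := by
      simp only [hKdef, ← hl, List.take_length]
      rfl
    rw [this]

/-- Cells with negative addresses are empty at the start, so all variables begin with zero. -/
theorem memoryOf_eq_mem (l : List ℤ) : memoryOf l = mem (memoryOf l) ⟨0, 0, 0, 0, 0, 0, 0, 0, 0⟩ := by
  funext x
  by_cases hx : 0 ≤ x
  · rw [mem_of_nonneg _ _ hx]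
  · have : memoryOf l x = 0 := if_neg hx
    unfold mem
    split_ifs <;> first | exact this | rfl

theorem exec_mainP (hr : ∀ i, ∀ y, r i ≤ y ↔ ∀ k,
      (∑ j, if I.perturbedValue T i k ≤ I.perturbedValue T i j then
        I.p i j * I.perturbedValue T i j else 0) - I.c i
      ≤ y * ∑ j, if I.perturbedValue T i k ≤ I.perturbedValue T i j then I.p i j else 0) :
    Exec (size I T) (lenBound (size I T)) mainP (input I T σ) fun s =>
      ∃ mv, s 0 = moveCode mv ∧ SearchProblem.IsGreedyMove (I.perturbedValue T) r σ mv := by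
  have hin := input_spec I T σ
  have hg := input_bounded I T σ
  have hA := le_lenBound (size I T)
  have h0 : len 0 ≤ lenBound (size I T) := le_trans (by decide : len 0 ≤ 84) (by omega)
  have h1 : len 1 ≤ lenBound (size I T) := le_trans (by decide : len 1 ≤ 84) (by omega)
  have hKlen : len (I.scale T) ≤ lenBound (size I T) :=
    (len_scale I T).trans (by unfold size at hA; unfold size; omega)
  rw [show input I T σ = mem (input I T σ) ⟨0, 0, 0, 0, 0, 0, 0, 0, 0⟩ from memoryOf_eq_mem _]
  have hb0 : (⟨0, 0, 0, 0, 0, 0, 0, 0, 0⟩ : Vars).Bounded (lenBound (size I T)) :=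
    ⟨h0, h0, h0, h0, h0, h0, h0, h0, h0⟩
  refine .seq ((exec_scaleP I T σ hb0 rfl).mono ?_)
  rintro _ rfl
  have hb1 : (⟨I.scale T, ((n + 4 * (n * m) : ℕ) : ℤ), 0, 0, 0, 0, 0, 0, 0⟩ : Vars).Bounded
      (lenBound (size I T)) := { hb0 with K := hKlen, i := hin.len_index_le le_rfl }
  refine .seq (exec_i (hb1.mem hg) ?_)
  simp only [Expr.eval]
  have hb2 : (⟨I.scale T, 0, 0, 0, 0, 0, 0, 0, 0⟩ : Vars).Bounded
      (lenBound (size I T)) := { hb0 with K := hKlen }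
  refine .seq (exec_BD (hb2.mem hg) ?_)
  simp only [Expr.eval]
  refine .seq ((Exec.loop n hin.le_left (fun i s => ∃ v, s = mem (input I T σ) v ∧
    Invariant I T σ r i (fun y => ∀ i' : Fin n, (i' : ℕ) < i →
      SearchProblem.score (I.perturbedValue T) r σ i' ≤ y) v) ?_ ?_ ?_).mono ?_)
  · rintro i hi _ ⟨v, rfl, hvK, hvi, hvb, hvt⟩
    refine ⟨hvb.mem hg, ?_⟩
    have e1 : mem (input I T σ) v 0 = n := by rw [mem_of_nonneg _ _ le_rfl, hin.zero]
    have e2 : mem (input I T σ) v (-2) = i := hvi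
    simp only [Expr.eval, e1, e2]
    omega
  · rintro i hi _ ⟨v, rfl, hv⟩
    have hDone : ∀ y y', y ≤ y' → (∀ i' : Fin n, (i' : ℕ) < i →
        SearchProblem.score (I.perturbedValue T) r σ i' ≤ y) → ∀ i' : Fin n, (i' : ℕ) < i →
        SearchProblem.score (I.perturbedValue T) r σ i' ≤ y' :=
      fun y y' hy h i' hi' => (h i' hi').trans hy
    have hs : situationE.eval (mem (input I T σ) v) = situationEntry σ i :=
      eval_situationE hin hv.2.1 hi
    have hse := situationEntry_eq σ ⟨i, hi⟩
    refine .seq (Exec.mono (Post := fun s => ∃ v', s = mem (input I T σ) v' ∧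
      Invariant I T σ r i (fun y => (∀ i' : Fin n, (i' : ℕ) < i →
        SearchProblem.score (I.perturbedValue T) r σ i' ≤ y) ∧
        SearchProblem.score (I.perturbedValue T) r σ ⟨i, hi⟩ ≤ y) v') ?_ ?_)
    · refine .ite (hv.2.2.1.mem hg) (fun h => ?_) (fun h => ?_)
      · rw [hs] at h
        cases hc : σ ⟨i, hi⟩ with
        | none => simp [hc] at hse; omega
        | some j => exact exec_openedP I T σ ⟨i, hi⟩ j hc hDone hv
      · rw [hs] at h
        cases hc : σ ⟨i, hi⟩ with
        | none => exact exec_closedP I T σ ⟨i, hi⟩ hc (hr _) hDone hv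
        | some j =>
          have hj : (0 : ℤ) ≤ (j : ℕ) := Int.natCast_nonneg _
          rw [hc] at hse
          simp only at hse
          omega
    · rintro _ ⟨w, rfl, hwK, hwi, hwb, mv, y, a1, a2, a3, a4, a5, a6, a7⟩
      have e2 : mem (input I T σ) w (-2) = i := hwi
      refine exec_i (hwb.mem hg) ⟨_, rfl, hwK, ?_, ?_, mv, y, a1, a2, a3, a4, a5, ?_⟩
      · simp only [Expr.eval, e2, Nat.cast_succ]
      · refine { hwb with i := ?_ }
        simp only [Expr.eval, e2]
        exact_mod_cast hin.len_index_le (by omega : i + 1 ≤ _)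
      · intro i' hi'
        rcases Nat.lt_succ_iff_lt_or_eq.1 hi' with h | h
        · exact a6 i' h
        · rwa [show i' = ⟨i, hi⟩ from Fin.ext h]
  -- The first candidate is to quit, with value `0 / 1`. Its code and the numerator are zeros of the
  -- initial memory; only `BD` had to be set.
  · exact ⟨_, rfl, rfl, rfl, { hb2 with BD := h1 }, .quit, 0, rfl, one_pos, by simp, le_rfl, le_refl (0 : ℚ),
      fun i' hi' => absurd hi' (Nat.not_lt_zero _)⟩
  · rintro _ ⟨v, rfl, -, -, hvb, mv, y, a1, a2, a3, a4, a5, a6⟩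
    refine .assign (hvb.mem hg) ⟨mv, ?_, a5.isGreedyMove a4 fun i => a6 i i.2⟩
    simp only [Expr.eval, Function.update_self]
    exact a1

end

end SearchProgram

/-! ### The main theorem -/

/-- There is a polynomial-time algorithm that computes, for every search problem and every contract,
an optimal policy under this contract. -/
theorem theorem1 :
    ∃ (P : RAM.Program) (q : Polynomial ℕ),
      ∀ (n m : ℕ) (I : SearchProblem n m) (T : Contract I),
        ∃ π : Policy n m, I.IsOptimalPolicy T π ∧
          ComputesPolicy P I T π (q.eval (RAM.listSize (inputCode I T))) := by
  refine ⟨SearchProgram.mainP,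
    SearchProgram.mainP.steps * (Polynomial.C 21 * (Polynomial.X + 2) ^ 2), fun n m I T => ?_⟩
  have hex := fun i => exists_reservationValue (I.p i) (I.perturbedValue T i) (I.c i)
    (I.p_nonneg i) (I.p_sum i) (I.c_nonneg i)
  choose r hr1 hr2 using hex
  have hrun := fun σ => SearchProgram.exec_mainP I T σ hr2
  -- The policy is read off from the outputs of the program, with `r` fixed beforehand for all
  -- situations; greediness of the moves includes their legality.
  choose s τ h1 h2 mv h3 h4 using hrun
  refine ⟨⟨mv, fun σ i h => ?_, fun σ i h => ?_⟩, I.isOptimalPolicy_of_greedy T r hr1 _ h4,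
    fun σ => ⟨s σ, τ σ, h1 σ, (h2 σ).trans (le_of_eq ?_), h3 σ⟩⟩
  · have := h4 σ
    rw [h] at this
    exact this.1
  · have := h4 σ
    rw [h] at this
    exact this.1
  · simp [SearchProgram.lenBound, SearchProgram.size]
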